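/- An arrangement of $d$ lines and $k$ conics is a collection of $d$ pairwise distinct lines and $k$ pairwise distinct smooth conics in $\mathbb{P}^2_{\mathbb{C}}$. Assume that all its singular points are ordinary (the tangent cone at a point of multiplicity $m$ consists of $m$ distinct lines). Let $n_i$ be the number of points where exactly $i$ of the curves meet. Its combinatorial Poincaré polynomial is $$\mathfrak{P}(\mathcal{CL};t)=1+(2k+d-1)t+\Big(\sum_{i\ge2}(i-1)n_i-d+1\Big)t^2 .$$ Let $f=0$ be the reduced equation of the union of the curves, $e=d+2k$ its degree, and $J_f=\langle\partial_xf,\partial_yf,\partial_zf\rangle\subset S=\mathbb{C}[x,y,z]$ the Jacobian ideal. Let $\deg J_f$ be the degree of the (at most zero-dimensional) subscheme of $\mathbb{P}^2_{\mathbb C}$ defined by $J_f$, that is, $\dim_{\mathbb C}(S/J_f)_s$ for all sufficiently large $s$. An arrangement $\mathcal{CL}$ with only ordinary singularities of multiplicity at most $4$ is an $\mathscr{M}$-arrangement if $e\ge5$ and $$\deg J_f=\begin{cases}3m^2-3m+3&\text{if }e=2m,\\ 3m^2+1&\text{if }e=2m+1.\end{cases}$$ **Theorem.** Let $\mathcal{CL}\subset\mathbb{P}^2_{\mathbb{C}}$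 be an $\mathscr{M}$-arrangement of $d\ge3$ lines and one smooth conic $C$ with only ordinary singularities of multiplicity at most $4$. Let $\mathcal{L}=\mathcal{CL}\setminus\{C\}$ be the line arrangement obtained by deleting $C$, and let $r=|C\cap\mathcal{L}|$ be the number of points of $C$ that lie on at least one of the lines. 1. If $d=2\ell$, then $\mathfrak{P}(\mathcal{L};t)=(\ell^2+\ell-2-r)t^2+(2\ell-1)t+1$. 2. If $d=2\ell+1$, then $\mathfrak{P}(\mathcal{L};t)=(\ell^2+2\ell-r)t^2+2\ell t+1$. -/

import Mathlib

open MvPolynomial Filter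
open scoped LinearAlgebra.Projectivization

noncomputable section

namespace ConicLine

/-- The coordinate ring `S = ℂ[x, y, z]` of the complex projective plane. -/
abbrev S : Type := MvPolynomial (Fin 3) ℂ

/-- The complex projective plane. -/
abbrev P2 : Type := ℙ ℂ (Fin 3 → ℂ)

/-- The form `f` vanishes at the point `p` (for homogeneous `f` this does not depend on the
representative of `p`). -/
def Vanishes (f : S) (p : P2) : Prop := eval p.rep f = 0

/-- `p` is a singular point of the curve `f = 0`. -/
def IsSingularPoint (f : S) (p : P2) : Prop :=
  Vanishes f p ∧ ∀ i : Fin 3, Vanishes (pderiv i f) p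

/-- `f` defines a smooth conic. -/
def IsSmoothConic (f : S) : Prop :=
  f.IsHomogeneous 2 ∧ ∀ p : P2, ¬ IsSingularPoint f p

/-- `f` defines a line. -/
def IsLine (f : S) : Prop := f.IsHomogeneous 1 ∧ f ≠ 0

/-- The expansion `f(p + X)` of `f` around `p ∈ ℂ³`. -/
def expandAt (f : S) (p : Fin 3 → ℂ) : S := aeval (fun i => X i + C (p i)) f

/-- The curve `f = 0` has multiplicity `m` at `p` and `p` is an ordinary point of it: the lowest
nonzero homogeneous part of `f` at `p` has degree `m`, and it has no repeated factor, so that the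
tangent cone consists of `m` distinct lines.

The expansion is taken in the three homogeneous coordinates. As `f` is homogeneous, the cone
`f = 0` is near `p` the product of the plane curve with a line, so the multiplicity is that of the
plane curve and the lowest form is the pull-back, under a linear projection `ℂ³ → ℂ³ / ℂ p`,
of the lowest form in affine local coordinates at `p`. -/
def IsOrdinaryPoint (f : S) (m : ℕ) (p : P2) : Prop :=
  (∀ j < m, homogeneousComponent j (expandAt f p.rep) = 0) ∧
    homogeneousComponent m (expandAt f p.rep) ≠ 0 ∧
    Squarefree (homogeneousComponent m (expandAt f p.rep))

/-- The Jacobian ideal `J_f`, generated by all the partial derivatives of `f`. -/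
def jacobianIdeal (f : S) : Ideal S := Ideal.span (Set.range fun i : Fin 3 => pderiv i f)

/-- The Hilbert function `s ↦ dim_ℂ (S / I)_s` of a homogeneous ideal `I`. -/
def hilbertFunction (I : Ideal S) (s : ℕ) : ℕ :=
  Module.finrank ℂ
    (homogeneousSubmodule (Fin 3) ℂ s ⧸
      (I.restrictScalars ℂ).comap (homogeneousSubmodule (Fin 3) ℂ s).subtype)

/-- The homogeneous ideal `I` defines a subscheme of the plane of dimension at most zero, and its
degree is `n`: the Hilbert polynomial of `S / I` is the constant `n`. -/
def HasDegree (I : Ideal S) (n : ℕ) : Prop := ∀ᶠ s in atTop, hilbertFunction I s = n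

/-- An arrangement of `d` lines and `k` smooth conics, pairwise distinct, in the complex projective
plane, each curve being given by an equation. -/
structure Arrangement (d k : ℕ) where
  line : Fin d → S
  conic : Fin k → S
  isLine : ∀ i, IsLine (line i)
  isSmoothConic : ∀ j, IsSmoothConic (conic j)
  line_distinct : ∀ i i', i ≠ i' → ¬ Associated (line i) (line i')
  conic_distinct : ∀ j j', j ≠ j' → ¬ Associated (conic j) (conic j')

namespace Arrangement

variable {d k : ℕ}

/-- The equation of the union of all curves of the arrangement; a form of degree `d + 2 k`,
which is reduced because the curves are irreducible and pairwise distinct. -/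
def equation (A : Arrangement d k) : S := (∏ i, A.line i) * ∏ j, A.conic j

open Classical in
/-- The number of curves of the arrangement that pass through `p`. -/
def numCurvesThrough (A : Arrangement d k) (p : P2) : ℕ :=
  (Finset.univ.filter fun i => Vanishes (A.line i) p).card +
    (Finset.univ.filter fun j => Vanishes (A.conic j) p).card

/-- `n_r`, the number of points of the plane where exactly `r` curves meet. -/
def numPoints (A : Arrangement d k) (r : ℕ) : ℕ := {p : P2 | A.numCurvesThrough p = r}.ncard

/-- The combinatorial Poincaré polynomial
`1 + (2k + d - 1) t + (∑_{r ≥ 2} (r - 1) n_r - d + 1) t²`. At most `d + k` curves meet in a point,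
so that `n_r = 0` for `r > d + k`. -/
def poincarePolynomial (A : Arrangement d k) : Polynomial ℤ :=
  1 + Polynomial.C (2 * (k : ℤ) + d - 1) * Polynomial.X +
    Polynomial.C ((∑ r ∈ Finset.Icc 2 (d + k), ((r : ℤ) - 1) * (A.numPoints r : ℤ)) - d + 1) *
      Polynomial.X ^ 2

/-- The arrangement obtained by deleting the `j`-th conic. -/
def deleteConic (A : Arrangement d (k + 1)) (j : Fin (k + 1)) : Arrangement d k where
  line := A.line
  conic := fun i => A.conic (j.succAbove i)
  isLine := A.isLine
  isSmoothConic := fun _ => A.isSmoothConic _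
  line_distinct := A.line_distinct
  conic_distinct := fun _ _ h =>
    A.conic_distinct _ _ (fun e => h (Fin.succAbove_right_injective e))

/-- The points that lie on the `j`-th conic and on some other curve of the arrangement. -/
def pointsOnConic (A : Arrangement d (k + 1)) (j : Fin (k + 1)) : Set P2 :=
  {p | Vanishes (A.conic j) p ∧ Vanishes (A.deleteConic j).equation p}

/-- Every singular point of the union of the curves is an ordinary point of multiplicity
at most `N`. -/
def HasOrdinarySingularities (A : Arrangement d k) (N : ℕ) : Prop :=
  ∀ p : P2, IsSingularPoint A.equation p → ∃ m ≤ N, IsOrdinaryPoint A.equation m p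

/-- An `ℳ`-arrangement with only ordinary singularities of multiplicity at most `4`: a reduced
curve of degree `e = d + 2 k ≥ 5` with such singularities whose Jacobian ideal has degree
`3 m² - 3 m + 3` if `e = 2 m`, and `3 m² + 1` if `e = 2 m + 1`.

In general the singularities of an `ℳ`-curve have to be of type ADE or simple elliptic. Ordinary
points of multiplicity 2, 3, 4 are of type `A₁`, of type `D₄`, and simple elliptic, respectively,
so that here nothing has to be added. -/
structure IsMArrangement (A : Arrangement d k) : Prop where
  ordinary : A.HasOrdinarySingularities 4
  five_le_degree : 5 ≤ d + 2 * k
  degree_even : ∀ m : ℕ, d + 2 * k = 2 * m →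
    HasDegree (jacobianIdeal A.equation) (3 * m ^ 2 - 3 * m + 3)
  degree_odd : ∀ m : ℕ, d + 2 * k = 2 * m + 1 →
    HasDegree (jacobianIdeal A.equation) (3 * m ^ 2 + 1)

end Arrangement

end ConicLine

end

/-! Let `t` be the number of lines through a point `p`, and let `c` be 1 or 0 according to whether
`p` lies on `C`. All singularities are ordinary, so a point with `t + c ≥ 2` has multiplicity `t +
c`, distinct tangents, and Tjurina number `(t + c - 1)²`. Since `deg J_f` is the sum of these
numbers and `c² = c`, `(t + c - 1)² = t(t - 1) - (t - 1) + 2ct - c` can be summed term by term. Two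
lines meet once, so `∑ t(t - 1) = d(d - 1)`. No line is tangent to `C`, so `∑ ct = 2d`. By
definition `∑ c = r`, and `∑ (t - 1)` is the sum `∑ (i - 1) n_i` of the line arrangement. Hence this
last sum equals `d(d - 1) + 4d - r - deg J_f`, and the prescribed value of `deg J_f` gives both
formulas.

The weight of the proof lies in `deg J_f = ∑ (t + c - 1)²`. Locally, the partial derivatives of a
squarefree binary form of degree `m` are coprime (`isRelPrime_pderiv`), and two power series with
coprime lowest forms of degree `n` have intersection number `n²`; here this is linear algebra modulo
a power of the maximal ideal (`finrank_quotient_pair`). For `m ≤ 4` the equation itself adds nothing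
to the ideal of its derivatives (`finrank_tjurina`). Globally, a line avoiding the singular points
is taken as the line at infinity; the degree is then the dimension of an affine coordinate ring
(`finrank_quotient_map_dehomogenize`), which splits into its local rings
(`finrank_quotient_eq_sum`). The lowest form of the equation is the product of those of the curves,
which ties ordinariness to the number of curves and to transversality. -/

namespace ConicLine

/-! ### Lowest homogeneous parts and powers of the ideal of the origin -/

section LowestForm

variable {σ : Type*}

/-- `G` is homogeneous of degree `m` and is the part of degree at most `m` of `F`. -/
def HasLowestForm (F : MvPolynomial σ ℂ) (m : ℕ) (G : MvPolynomial σ ℂ) : Prop :=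
  G.IsHomogeneous m ∧ F - G ∈ idealOfVars σ ℂ ^ (m + 1)

theorem isHomogeneous_mem_pow {G : MvPolynomial σ ℂ} {m : ℕ} (hG : G.IsHomogeneous m) :
    G ∈ idealOfVars σ ℂ ^ m := by
  rw [mem_pow_idealOfVars_iff']
  intro x hx
  exact hG.coeff_eq_zero (by omega)

theorem homogeneousComponent_eq_zero_of_mem_pow {F : MvPolynomial σ ℂ} {m j : ℕ}
    (hF : F ∈ idealOfVars σ ℂ ^ m) (hj : j < m) : homogeneousComponent j F = 0 := by
  rw [mem_pow_idealOfVars_iff'] at hF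
  ext x
  rw [coeff_homogeneousComponent]
  split_ifs with h
  · rw [hF x (by omega)]; simp
  · simp

theorem eq_zero_of_isHomogeneous_of_mem_pow {G : MvPolynomial σ ℂ} {m n : ℕ} (hG : G.IsHomogeneous m)
    (h : G ∈ idealOfVars σ ℂ ^ n) (hmn : m < n) : G = 0 := by
  rw [← homogeneousComponent_eq_self hG]
  exact homogeneousComponent_eq_zero_of_mem_pow h hmn

theorem sub_homogeneousComponent_mem {F : MvPolynomial σ ℂ} {m : ℕ}
    (h : F ∈ idealOfVars σ ℂ ^ m) :
    F - homogeneousComponent m F ∈ idealOfVars σ ℂ ^ (m + 1) := by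
  rw [mem_pow_idealOfVars_iff'] at h ⊢
  intro x hx
  rw [coeff_sub, coeff_homogeneousComponent]
  split_ifs with hd
  · simp
  · rw [h x (by omega)]; simp

theorem pderiv_mem_pow {F : MvPolynomial σ ℂ} {m : ℕ} (i : σ)
    (h : F ∈ idealOfVars σ ℂ ^ (m + 1)) : pderiv i F ∈ idealOfVars σ ℂ ^ m := by
  rw [mem_pow_idealOfVars_iff'] at h ⊢
  intro x hx
  rw [coeff_pderiv, h]
  · simp
  · simp only [map_add, Finsupp.degree_single]; omega

namespace HasLowestForm

variable {F F' G G' : MvPolynomial σ ℂ} {m m' : ℕ}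

theorem mem_pow (h : HasLowestForm F m G) : F ∈ idealOfVars σ ℂ ^ m := by
  have := add_mem (Ideal.pow_le_pow_right (Nat.le_succ m) h.2) (isHomogeneous_mem_pow h.1)
  simpa using this

theorem mul (h : HasLowestForm F m G) (h' : HasLowestForm F' m' G') :
    HasLowestForm (F * F') (m + m') (G * G') := by
  refine ⟨h.1.mul h'.1, ?_⟩
  have h1 := Ideal.mul_mem_mul h.mem_pow h'.2
  have h2 := Ideal.mul_mem_mul h.2 (isHomogeneous_mem_pow h'.1)
  rw [← pow_add] at h1 h2
  rw [show m + 1 + m' = m + m' + 1 by ring] at h2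
  rw [← add_assoc] at h1
  rw [show F * F' - G * G' = F * (F' - G') + (F - G) * G' by ring]
  exact add_mem h1 h2

theorem const (c : ℂ) {F : MvPolynomial σ ℂ} (h : F - C c ∈ idealOfVars σ ℂ) :
    HasLowestForm F 0 (C c) := ⟨isHomogeneous_C _ _, by simpa using h⟩

theorem prod {ι : Type*} (s : Finset ι) {F G : ι → MvPolynomial σ ℂ} {m : ι → ℕ}
    (h : ∀ i ∈ s, HasLowestForm (F i) (m i) (G i)) :
    HasLowestForm (∏ i ∈ s, F i) (∑ i ∈ s, m i) (∏ i ∈ s, G i) := by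
  classical
  induction s using Finset.induction_on with
  | empty => simpa using const (σ := σ) 1 (F := 1) (by simp)
  | insert i s hi ih =>
    rw [Finset.prod_insert hi, Finset.prod_insert hi, Finset.sum_insert hi]
    exact (h i (by simp)).mul (ih fun j hj => h j (by simp [hj]))

theorem homogeneousComponent_eq (h : HasLowestForm F m G) : homogeneousComponent m F = G := by
  have := homogeneousComponent_eq_zero_of_mem_pow h.2 (Nat.lt_succ_self m)
  rw [map_sub, homogeneousComponent_eq_self h.1, sub_eq_zero] at this
  exact this

theorem pderiv (h : HasLowestForm F (m + 1) G) (i : σ) :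
    HasLowestForm (pderiv i F) m (MvPolynomial.pderiv i G) :=
  ⟨by simpa using h.1.pderiv (i := i), by rw [← map_sub]; exact pderiv_mem_pow i h.2⟩

theorem aeval {τ : Type*} (h : HasLowestForm F m G) (L : σ → MvPolynomial τ ℂ)
    (hL : ∀ i, (L i).IsHomogeneous 1) :
    HasLowestForm (MvPolynomial.aeval L F) m (MvPolynomial.aeval L G) := by
  refine ⟨by simpa using h.1.aeval L hL, ?_⟩
  rw [← map_sub]
  have : (idealOfVars σ ℂ).map (MvPolynomial.aeval L) ≤ idealOfVars τ ℂ := by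
    rw [idealOfVars, Ideal.map_span, Ideal.span_le]
    rintro _ ⟨_, ⟨i, rfl⟩, rfl⟩
    rw [MvPolynomial.aeval_X]
    simpa using isHomogeneous_mem_pow (hL i)
  have h2 := Ideal.mem_map_of_mem (MvPolynomial.aeval L) h.2
  rw [Ideal.map_pow] at h2
  exact Ideal.pow_right_mono this _ h2

/-- The degree of a nonzero lowest form and the form itself are determined. -/
theorem unique (h : HasLowestForm F m G) (hG : G ≠ 0)
    (h0 : ∀ j < m', homogeneousComponent j F = 0) (h1 : homogeneousComponent m' F ≠ 0) :
    m' = m ∧ homogeneousComponent m' F = G := by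
  have : m' = m := by
    rcases lt_trichotomy m m' with hlt | heq | hgt
    · exact absurd ((h.homogeneousComponent_eq).symm.trans (h0 m hlt)) hG
    · exact heq.symm
    · exact absurd (homogeneousComponent_eq_zero_of_mem_pow h.mem_pow hgt) h1
  subst this
  exact ⟨rfl, h.homogeneousComponent_eq⟩

end HasLowestForm

end LowestForm

/-! ### Dimensions of spaces of binary forms -/

section Forms

theorem ncard_degree_eq (k : ℕ) : {d : Fin 2 →₀ ℕ | d.degree = k}.ncard = k + 1 := by
  have h : {d : Fin 2 →₀ ℕ | d.degree = k} =
      ((Finset.univ : Finset (Fin 2)).finsuppAntidiag k : Set (Fin 2 →₀ ℕ)) := by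
    ext d
    simp [Finsupp.degree_eq_sum]
  rw [h, Set.ncard_coe_finset]
  exact (Finset.card_finsuppAntidiag_nat_eq_choose k).trans (by simp [show 2 + k - 1 = k + 1 by omega])

theorem finite_degree_lt (k : ℕ) : {d : Fin 2 →₀ ℕ | d.degree < k}.Finite :=
  (Finsupp.finite_of_degree_le k).subset (Set.ofPred_subset_ofPred.2 fun _ h => h.le)

theorem ncard_degree_lt (k : ℕ) :
    2 * {d : Fin 2 →₀ ℕ | d.degree < k}.ncard = k * (k + 1) := by
  induction k with
  | zero => simp
  | succ k ih =>
    have h : {d : Fin 2 →₀ ℕ | d.degree < k + 1} =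
        {d | d.degree < k} ∪ {d | d.degree = k} := by
      ext d; simp only [Set.mem_ofPred_eq, Set.mem_union]; omega
    have hf : {d : Fin 2 →₀ ℕ | d.degree = k}.Finite :=
      Set.finite_of_ncard_pos (by rw [ncard_degree_eq]; omega)
    rw [h, Set.ncard_union_eq _ (finite_degree_lt k) hf, ncard_degree_eq, mul_add, ih]
    · ring
    · rw [Set.disjoint_left]; intro d h1 h2; simp only [Set.mem_ofPred_eq] at h1 h2; omega

theorem finrank_restrictSupport {σ : Type*} (s : Set (σ →₀ ℕ)) :
    Module.finrank ℂ (restrictSupport ℂ s) = s.ncard := by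
  rw [Module.finrank_eq_nat_card_basis (basisRestrictSupport ℂ s), Nat.card_coe_set_eq]

theorem finrank_homogeneousSubmodule (k : ℕ) :
    Module.finrank ℂ (homogeneousSubmodule (Fin 2) ℂ k) = k + 1 := by
  rw [homogeneousSubmodule_eq_finsupp_supported]
  exact (finrank_restrictSupport _).trans (ncard_degree_eq k)

instance finite_homogeneousSubmodule {σ : Type*} [Finite σ] (k : ℕ) :
    Module.Finite ℂ (homogeneousSubmodule σ ℂ k) :=
  Module.Finite.iff_fg.2 (homogeneousSubmodule_fg σ ℂ k)

/-- The polynomials of degree less than `k`. -/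
noncomputable abbrev degreeLT (k : ℕ) : Submodule ℂ (MvPolynomial (Fin 2) ℂ) :=
  restrictSupport ℂ {d | d.degree < k}

instance (k : ℕ) : Module.Finite ℂ (degreeLT k) := by
  have := (finite_degree_lt k).to_subtype
  exact Module.Finite.of_basis (basisRestrictSupport ℂ {d : Fin 2 →₀ ℕ | d.degree < k})

theorem mem_degreeLT {k : ℕ} {p : MvPolynomial (Fin 2) ℂ} :
    p ∈ degreeLT k ↔ ∀ d : Fin 2 →₀ ℕ, k ≤ d.degree → coeff d p = 0 := by
  rw [mem_restrictSupport_iff]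
  constructor
  · intro h d hd
    by_contra hc
    exact absurd (h (mem_support_iff.2 hc)) (by simpa using hd)
  · intro h d hd
    by_contra hc
    exact (mem_support_iff.1 hd) (h d (by simpa using hc))

theorem isCompl_degreeLT (k : ℕ) :
    IsCompl (((idealOfVars (Fin 2) ℂ) ^ k).restrictScalars ℂ) (degreeLT k) := by
  constructor
  · rw [Submodule.disjoint_def]
    intro p h1 h2
    rw [Submodule.restrictScalars_mem, mem_pow_idealOfVars_iff'] at h1
    rw [mem_degreeLT] at h2
    ext d
    rcases lt_or_ge d.degree k with h | h
    · rw [h1 d h, coeff_zero]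
    · rw [h2 d h, coeff_zero]
  · rw [codisjoint_iff, eq_top_iff]
    intro p _
    have hq : (∑ j ∈ Finset.range k, homogeneousComponent j p) ∈ degreeLT k := by
      rw [mem_degreeLT]
      intro d hd
      rw [coeff_sum]
      refine Finset.sum_eq_zero fun j hj => ?_
      rw [coeff_homogeneousComponent, if_neg]
      have := Finset.mem_range.1 hj
      omega
    refine Submodule.mem_sup.2 ⟨p - ∑ j ∈ Finset.range k, homogeneousComponent j p, ?_, _, hq,
      by simp⟩
    rw [Submodule.restrictScalars_mem, mem_pow_idealOfVars_iff']
    intro d hd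
    rw [coeff_sub, coeff_sum, Finset.sum_eq_single d.degree]
    · rw [coeff_homogeneousComponent, if_pos rfl, sub_self]
    · intro j _ hj
      rw [coeff_homogeneousComponent, if_neg (Ne.symm hj)]
    · intro h; exact absurd (Finset.mem_range.2 hd) h

theorem exists_degreeLT_sub_mem (k : ℕ) (p : MvPolynomial (Fin 2) ℂ) :
    ∃ q ∈ degreeLT k, p - q ∈ idealOfVars (Fin 2) ℂ ^ k := by
  obtain ⟨y, hy, z, hz, h⟩ := Submodule.mem_sup.1
    ((isCompl_degreeLT k).sup_eq_top ▸ Submodule.mem_top : p ∈ _ ⊔ _)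
  exact ⟨z, hz, by rw [← h]; simpa using hy⟩

end Forms

/-! ### Coprime binary forms -/

section Syzygy

variable {a b : MvPolynomial (Fin 2) ℂ} {n : ℕ}

theorem ne_zero_of_isRelPrime (hn : 1 ≤ n) (hb : b.IsHomogeneous n) (h : IsRelPrime a b) :
    a ≠ 0 := by
  rintro rfl
  have hu : IsUnit b := h (dvd_zero b) dvd_rfl
  have h0 := hb.totalDegree hu.ne_zero
  rw [isUnit_iff_totalDegree_of_isReduced] at hu
  omega

/-- Coprimality forces `a ∣ e`, and `e` has smaller degree than `a`. -/
theorem syzygy_eq_zero (hn : 1 ≤ n) (ha : a.IsHomogeneous n) (hb : b.IsHomogeneous n)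
    (hab : IsRelPrime a b) {j : ℕ} (hj : j < n) {c e : MvPolynomial (Fin 2) ℂ}
    (he : e.IsHomogeneous j) (h : c * a + e * b = 0) : c = 0 ∧ e = 0 := by
  have ha0 := ne_zero_of_isRelPrime hn hb hab
  have hd : a ∣ e * b := ⟨-c, by linear_combination h⟩
  obtain ⟨k, rfl⟩ := hab.dvd_of_dvd_mul_right hd
  have hk : k = 0 := by
    by_contra hk
    have h1 := he.totalDegree (mul_ne_zero ha0 hk)
    rw [totalDegree_mul_of_isDomain ha0 hk, ha.totalDegree ha0] at h1
    omega
  subst hk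
  simpa [ha0] using h

/-- The map `(c, e) ↦ c a + e b` on pairs of forms of degree `n - 1` is injective by
`syzygy_eq_zero`, and its source and target both have dimension `2n`. -/
theorem exists_combination (hn : 1 ≤ n) (ha : a.IsHomogeneous n) (hb : b.IsHomogeneous n)
    (hab : IsRelPrime a b) {p : MvPolynomial (Fin 2) ℂ} (hp : p.IsHomogeneous (2 * n - 1)) :
    ∃ c e, c.IsHomogeneous (n - 1) ∧ e.IsHomogeneous (n - 1) ∧ c * a + e * b = p := by
  let H := homogeneousSubmodule (Fin 2) ℂ
  have hmem : ∀ x : H (n - 1) × H (n - 1), x.1.1 * a + x.2.1 * b ∈ H (2 * n - 1) := by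
    intro x
    have h1 := (IsHomogeneous.mul x.1.2 ha).add (IsHomogeneous.mul x.2.2 hb)
    rw [show n - 1 + n = 2 * n - 1 by omega] at h1
    exact h1
  let Φ : (H (n - 1) × H (n - 1)) →ₗ[ℂ] H (2 * n - 1) :=
    { toFun := fun x => ⟨x.1.1 * a + x.2.1 * b, hmem x⟩
      map_add' := fun x y => by ext1; simp; ring
      map_smul' := fun r x => by ext1; simp }
  have hinj : Function.Injective Φ := by
    rw [← LinearMap.ker_eq_bot, LinearMap.ker_eq_bot']
    intro x hx
    have h1 : x.1.1 * a + x.2.1 * b = 0 := congrArg Subtype.val hx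
    obtain ⟨h2, h3⟩ := syzygy_eq_zero hn ha hb hab (by omega) x.2.2 h1
    ext1 <;> ext1 <;> assumption
  have hsurj : Function.Surjective Φ := by
    refine (LinearMap.injective_iff_surjective_of_finrank_eq_finrank ?_).1 hinj
    rw [Module.finrank_prod, finrank_homogeneousSubmodule, finrank_homogeneousSubmodule]
    omega
  obtain ⟨x, hx⟩ := hsurj ⟨p, hp⟩
  exact ⟨x.1.1, x.2.1, x.1.2, x.2.2, congrArg Subtype.val hx⟩

/-- The partial derivatives of a squarefree binary form are coprime. -/
theorem isRelPrime_pderiv {G : MvPolynomial (Fin 2) ℂ} {m : ℕ} (hm : m ≠ 0)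
    (hG : G.IsHomogeneous m) (hs : Squarefree G) : IsRelPrime (pderiv 0 G) (pderiv 1 G) := by
  have hG0 : G ≠ 0 := hs.ne_zero
  refine WfDvdMonoid.isRelPrime_of_no_irreducible_factors ?_ ?_
  · rintro ⟨h0, h1⟩
    have := hG.sum_X_mul_pderiv
    rw [Fin.sum_univ_two, h0, h1] at this
    simp [hm, hG0] at this
  · intro h hirr h0 h1
    have hprime := hirr.prime
    have hdG : h ∣ G := by
      have he := hG.sum_X_mul_pderiv
      rw [Fin.sum_univ_two] at he
      have h2 : h ∣ m • G := he ▸ dvd_add (h0.mul_left _) (h1.mul_left _)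
      have h3 : G = C ((m : ℂ)⁻¹) * (m • G) := by
        rw [nsmul_eq_mul, ← mul_assoc, ← C_eq_coe_nat, ← C_mul,
          inv_mul_cancel₀ (by exact_mod_cast hm), C_1, one_mul]
      rw [h3]
      exact h2.mul_left _
    obtain ⟨k, rfl⟩ := hdG
    have hk : ¬ h ∣ k := fun ⟨k', hk'⟩ =>
      hirr.not_isUnit (hs h ⟨k', by rw [hk', mul_assoc]⟩)
    -- By the product rule `h` divides `k ∂ᵢh`, hence `∂ᵢh`, whose degree is too small unless it is
    -- zero. With both derivatives zero, characteristic 0 makes `h` constant.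
    have key : ∀ i, h ∣ pderiv i (h * k) → pderiv i h = 0 := by
      intro i hi
      rw [pderiv_mul] at hi
      have h3 : h ∣ pderiv i h * k := (dvd_add_left (Dvd.intro _ rfl)).1 hi
      have h4 := (hprime.dvd_or_dvd h3).resolve_right hk
      by_contra hne
      obtain ⟨q, hq⟩ := h4
      have hh0 := hirr.ne_zero
      have hq0 : q ≠ 0 := by rintro rfl; simp at hq; exact hne hq
      have hdeg := congrArg totalDegree hq
      rw [totalDegree_mul_of_isDomain hh0 hq0] at hdeg
      have hlt : (pderiv i h).totalDegree < h.totalDegree := by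
        have h5 : 0 < h.totalDegree := by
          rw [Nat.pos_iff_ne_zero]
          intro h6
          exact hirr.not_isUnit (isUnit_iff_totalDegree_of_isReduced.2
            ⟨by
              rw [totalDegree_eq_zero_iff_eq_C] at h6
              rw [isUnit_iff_ne_zero]
              intro h7
              rw [h7, C_0] at h6
              exact hh0 h6, h6⟩)
        rw [totalDegree, Finset.sup_lt_iff (by simpa using h5)]
        intro d hd
        rw [mem_support_iff, coeff_pderiv] at hd
        have h7 : d + Finsupp.single i 1 ∈ h.support :=
          mem_support_iff.2 (left_ne_zero_of_mul hd)
        have h8 := le_totalDegree h7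
        have h9 : (d + Finsupp.single i 1).degree = d.degree + 1 := by simp
        change d.degree < _
        change (d + Finsupp.single i 1).degree ≤ _ at h8
        omega
      omega
    have k0 := key 0 h0
    have k1 := key 1 h1
    have hconst : ∀ d : Fin 2 →₀ ℕ, d ≠ 0 → coeff d h = 0 := by
      intro d hd
      obtain ⟨i, hi⟩ : ∃ i, d i ≠ 0 := by
        by_contra hc; push Not at hc; exact hd (Finsupp.ext hc)
      have hz : pderiv i h = 0 := by fin_cases i <;> assumption
      have h2 := congrArg (coeff (d - Finsupp.single i 1)) hz
      rw [coeff_pderiv, tsub_add_cancel_of_le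
        (Finsupp.single_le_iff.2 (Nat.one_le_iff_ne_zero.2 hi))] at h2
      rw [coeff_zero, mul_eq_zero] at h2
      refine h2.resolve_right ?_
      exact Nat.cast_add_one_ne_zero _
    refine hirr.not_isUnit (isUnit_iff.2 ⟨?_, fun d hd => by rw [hconst d hd]; exact .zero⟩)
    rw [isUnit_iff_ne_zero]
    intro hc
    refine hirr.ne_zero (MvPolynomial.ext _ _ fun d => ?_)
    by_cases hd : d = 0
    · rw [hd, hc, coeff_zero]
    · rw [hconst d hd, coeff_zero]

end Syzygy

/-! ### Local intersection and Tjurina numbers at the origin -/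

section LocalDegree

local notation "R" => MvPolynomial (Fin 2) ℂ
local notation "𝔪" => idealOfVars (Fin 2) ℂ

variable {a b g₁ g₂ : R} {n : ℕ}

theorem combination_mem_pow (h₁ : HasLowestForm g₁ n a) (h₂ : HasLowestForm g₂ n b)
    {j : ℕ} {x y : R} (hx : x ∈ 𝔪 ^ j) (hy : y ∈ 𝔪 ^ j) : x * g₁ + y * g₂ ∈ 𝔪 ^ (j + n) := by
  rw [pow_add]
  exact add_mem (Ideal.mul_mem_mul hx h₁.mem_pow) (Ideal.mul_mem_mul hy h₂.mem_pow)

/-- If `x` and `y` start in degree `j < n - 1` with parts `c` and `e`, then `c a + e b` has degree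
`j + n < 2n - 1` and must vanish, so `c = e = 0` and both start one degree later. -/
theorem mem_pow_of_combination_mem (hn : 1 ≤ n) (h₁ : HasLowestForm g₁ n a)
    (h₂ : HasLowestForm g₂ n b) (hab : IsRelPrime a b) {x y : R}
    (h : x * g₁ + y * g₂ ∈ 𝔪 ^ (2 * n - 1)) (j : ℕ) (hj : j ≤ n - 1) :
    x ∈ 𝔪 ^ j ∧ y ∈ 𝔪 ^ j := by
  induction j with
  | zero => simp
  | succ j ih =>
    obtain ⟨hx, hy⟩ := ih (by omega)
    set c := homogeneousComponent j x
    set e := homogeneousComponent j y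
    have hc : x - c ∈ 𝔪 ^ (j + 1) := sub_homogeneousComponent_mem hx
    have he : y - e ∈ 𝔪 ^ (j + 1) := sub_homogeneousComponent_mem hy
    have hch : c.IsHomogeneous j := homogeneousComponent_isHomogeneous j x
    have heh : e.IsHomogeneous j := homogeneousComponent_isHomogeneous j y
    have hle : 𝔪 ^ (2 * n - 1) ≤ 𝔪 ^ (j + n + 1) := Ideal.pow_le_pow_right (by omega)
    have h3 := ((show HasLowestForm x j c from ⟨hch, hc⟩).mul h₁).2
    have h4 := ((show HasLowestForm y j e from ⟨heh, he⟩).mul h₂).2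
    have h5 : c * a + e * b ∈ 𝔪 ^ (j + n + 1) := by
      have := sub_mem (hle h) (add_mem h3 h4)
      rwa [show x * g₁ + y * g₂ - (x * g₁ - c * a + (y * g₂ - e * b)) = c * a + e * b by ring]
        at this
    have h6 := eq_zero_of_isHomogeneous_of_mem_pow ((hch.mul h₁.1).add (heh.mul h₂.1)) h5
      (Nat.lt_succ_self _)
    obtain ⟨h7, h8⟩ := syzygy_eq_zero hn h₁.1 h₂.1 hab (by omega) heh h6
    rw [h7, sub_zero] at hc
    rw [h8, sub_zero] at he
    exact ⟨hc, he⟩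

/-- Two polynomials with coprime lowest forms of degree `n` have intersection number `n²` at the
origin. -/
theorem finrank_quotient_pair (hn : 1 ≤ n) (h₁ : HasLowestForm g₁ n a)
    (h₂ : HasLowestForm g₂ n b) (hab : IsRelPrime a b) :
    Module.finrank ℂ (R ⧸ (Ideal.span {g₁, g₂} ⊔ 𝔪 ^ (2 * n - 1))) = n ^ 2 := by
  set D := 2 * n - 1 with hD
  set K := Ideal.span {g₁, g₂} ⊔ 𝔪 ^ D with hK
  have hle : 𝔪 ^ D ≤ K := le_sup_right
  let e := Submodule.quotientEquivOfIsCompl _ _ (isCompl_degreeLT D)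
  have hV : Module.finrank ℂ (R ⧸ (𝔪 ^ D)) = {d : Fin 2 →₀ ℕ | d.degree < D}.ncard :=
    (LinearEquiv.finrank_eq (show (R ⧸ (𝔪 ^ D)) ≃ₗ[ℂ] degreeLT D from e)).trans
      (finrank_restrictSupport _)
  have hfin : Module.Finite ℂ (R ⧸ (𝔪 ^ D)) :=
    Module.Finite.equiv (show (R ⧸ (𝔪 ^ D)) ≃ₗ[ℂ] degreeLT D from e).symm
  let π : (R ⧸ (𝔪 ^ D)) →ₗ[ℂ] (R ⧸ K) := (Ideal.Quotient.factorₐ ℂ hle).toLinearMap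
  have hπ : Function.Surjective π := Ideal.Quotient.factor_surjective hle
  -- The terms of `x` and `y` of degree at least `n - 1` only contribute to `𝔪 ^ D`, so `K / 𝔪 ^ D`
  -- is the injective image of pairs of polynomials of degree below `n - 1`. The codimension is
  -- `n(2n - 1) - n(n - 1) = n²`.
  let Φ : (degreeLT (n - 1) × degreeLT (n - 1)) →ₗ[ℂ] (R ⧸ (𝔪 ^ D)) :=
    { toFun := fun x => Ideal.Quotient.mk _ (x.1.1 * g₁ + x.2.1 * g₂)
      map_add' := fun x y => by
        rw [← map_add]; congr 1; simp only [Prod.fst_add, Prod.snd_add, Submodule.coe_add]; ring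
      map_smul' := fun r x => by
        rw [RingHom.id_apply, ← Ideal.Quotient.mkₐ_eq_mk ℂ, ← map_smul]; congr 1
        simp [smul_add] }
  have hΦ : Function.Injective Φ := by
    rw [← LinearMap.ker_eq_bot, LinearMap.ker_eq_bot']
    intro x hx
    have h1 : x.1.1 * g₁ + x.2.1 * g₂ ∈ 𝔪 ^ D := Ideal.Quotient.eq_zero_iff_mem.1 hx
    obtain ⟨h2, h3⟩ := mem_pow_of_combination_mem hn h₁ h₂ hab h1 (n - 1) le_rfl
    have hdis := Submodule.disjoint_def.1 (isCompl_degreeLT (n - 1)).1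
    ext1 <;> ext1
    · exact hdis _ h2 x.1.2
    · exact hdis _ h3 x.2.2
  have hker : LinearMap.ker π = LinearMap.range Φ := by
    ext v
    obtain ⟨p, rfl⟩ := Ideal.Quotient.mk_surjective v
    rw [LinearMap.mem_ker, LinearMap.mem_range]
    have hp : π (Ideal.Quotient.mk _ p) = Ideal.Quotient.mk K p := rfl
    rw [hp, Ideal.Quotient.eq_zero_iff_mem]
    constructor
    · intro h
      obtain ⟨q, hq, z, hz, rfl⟩ := Submodule.mem_sup.1 h
      obtain ⟨x, y, rfl⟩ := Ideal.mem_span_pair.1 hq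
      obtain ⟨x', hx', hx⟩ := exists_degreeLT_sub_mem (n - 1) x
      obtain ⟨y', hy', hy⟩ := exists_degreeLT_sub_mem (n - 1) y
      refine ⟨(⟨x', hx'⟩, ⟨y', hy'⟩), ?_⟩
      refine Ideal.Quotient.eq.2 ?_
      have h3 := combination_mem_pow h₁ h₂ hx hy
      rw [show n - 1 + n = D by omega] at h3
      have h4 := neg_mem (add_mem h3 hz)
      rwa [show -((x - x') * g₁ + (y - y') * g₂ + z) =
        x' * g₁ + y' * g₂ - (x * g₁ + y * g₂ + z) by ring] at h4
    · rintro ⟨x, hx⟩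
      have h3 : x.1.1 * g₁ + x.2.1 * g₂ - p ∈ 𝔪 ^ D := Ideal.Quotient.eq.1 hx
      have h4 : x.1.1 * g₁ + x.2.1 * g₂ ∈ K :=
        Ideal.mem_sup_left (Ideal.mem_span_pair.2 ⟨_, _, rfl⟩)
      have h5 := sub_mem h4 (hle h3)
      rwa [sub_sub_cancel] at h5
  have hrk := LinearMap.finrank_range_add_finrank_ker π
  rw [hker, LinearMap.finrank_range_of_inj hΦ, LinearMap.range_eq_top.2 hπ, finrank_top, hV,
    Module.finrank_prod, finrank_restrictSupport] at hrk
  have h1 := ncard_degree_lt D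
  have h2 := ncard_degree_lt (n - 1)
  obtain ⟨k, rfl⟩ : ∃ k, n = k + 1 := ⟨n - 1, by omega⟩
  rw [show D = 2 * k + 1 by omega] at h1 hrk
  rw [Nat.add_sub_cancel] at h2 hrk
  nlinarith

/-- All forms of degree `2n - 1` lie in the ideal of the lowest forms, which gives the case `i = 1`;
multiplying that inclusion by `𝔪 ^ i` gives the induction step. Thus the quotient does not depend on
the truncation order. -/
theorem pow_le_span_sup_pow (hn : 1 ≤ n) (h₁ : HasLowestForm g₁ n a)
    (h₂ : HasLowestForm g₂ n b) (hab : IsRelPrime a b) (i : ℕ) :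
    𝔪 ^ (2 * n - 1) ≤ Ideal.span {g₁, g₂} ⊔ 𝔪 ^ (2 * n - 1 + i) := by
  have hbase : 𝔪 ^ (2 * n - 1) ≤ Ideal.span {g₁, g₂} ⊔ 𝔪 ^ (2 * n - 1 + 1) := by
    intro p hp
    obtain ⟨c, e, hc, he, hce⟩ := exists_combination hn h₁.1 h₂.1 hab
      (homogeneousComponent_isHomogeneous (2 * n - 1) p)
    have h3 := sub_homogeneousComponent_mem hp
    have h4 := Ideal.mul_mem_mul (isHomogeneous_mem_pow hc) h₁.2
    have h5 := Ideal.mul_mem_mul (isHomogeneous_mem_pow he) h₂.2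
    rw [← pow_add, show n - 1 + (n + 1) = 2 * n - 1 + 1 by omega] at h4 h5
    refine Submodule.mem_sup.2 ⟨c * g₁ + e * g₂, Ideal.mem_span_pair.2 ⟨_, _, rfl⟩, _,
      sub_mem h3 (add_mem h4 h5), ?_⟩
    rw [← hce]; ring
  induction i with
  | zero => exact le_sup_right
  | succ i ih =>
    refine ih.trans (sup_le le_sup_left ?_)
    have h3 : 𝔪 ^ i * 𝔪 ^ (2 * n - 1) ≤ 𝔪 ^ i * (Ideal.span {g₁, g₂} ⊔ 𝔪 ^ (2 * n - 1 + 1)) :=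
      Ideal.mul_mono_right hbase
    rw [Ideal.mul_sup, ← pow_add, ← pow_add, add_comm i,
      show i + (2 * n - 1 + 1) = 2 * n - 1 + (i + 1) by ring] at h3
    exact h3.trans (sup_le_sup_right Ideal.mul_le_right _)

/-- The Tjurina number of an ordinary point of multiplicity `m ≤ 4` is `(m - 1)²`. -/
theorem finrank_tjurina {g G : R} {m : ℕ} (hm : 2 ≤ m) (hm' : m ≤ 4) (hg : HasLowestForm g m G)
    (hG : Squarefree G) {N : ℕ} (hN : 2 * m - 3 ≤ N) :
    Module.finrank ℂ (R ⧸ (Ideal.span {g, pderiv 0 g, pderiv 1 g} ⊔ 𝔪 ^ N)) = (m - 1) ^ 2 := by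
  obtain ⟨n, rfl⟩ : ∃ n, m = n + 1 := ⟨m - 1, by omega⟩
  have h₁ := hg.pderiv 0
  have h₂ := hg.pderiv 1
  have hab := isRelPrime_pderiv (by omega) hg.1 hG
  have hn : 1 ≤ n := by omega
  -- Euler's relation for the lowest form holds for `g` up to an error in `𝔪 ^ (n + 2)`. This error
  -- is absorbed because `2n - 1 ≤ n + 2`, which is where `m = n + 1 ≤ 4` enters.
  have hgmem : g ∈ Ideal.span {pderiv 0 g, pderiv 1 g} ⊔ 𝔪 ^ (2 * n - 1) := by
    have he := hg.1.sum_X_mul_pderiv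
    rw [Fin.sum_univ_two] at he
    have hX : ∀ i, (X i : R) ∈ 𝔪 := fun i => Ideal.subset_span ⟨i, rfl⟩
    have h3 := Ideal.mul_mem_mul (hX 0) h₁.2
    have h4 := Ideal.mul_mem_mul (hX 1) h₂.2
    rw [← pow_succ'] at h3 h4
    have h5 : ((n + 1 : ℕ) : R) * g - (X 0 * pderiv 0 g + X 1 * pderiv 1 g) ∈ 𝔪 ^ (n + 1 + 1) := by
      rw [nsmul_eq_mul] at he
      have := sub_mem (Ideal.mul_mem_left _ ((n + 1 : ℕ) : R) hg.2) (add_mem h3 h4)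
      convert this using 1
      linear_combination -he
    have h6 : ((n + 1 : ℕ) : R) * g ∈ Ideal.span {pderiv 0 g, pderiv 1 g} ⊔ 𝔪 ^ (2 * n - 1) := by
      refine Submodule.mem_sup.2 ⟨X 0 * pderiv 0 g + X 1 * pderiv 1 g,
        Ideal.mem_span_pair.2 ⟨_, _, rfl⟩, _, Ideal.pow_le_pow_right (by omega) h5, by ring⟩
    have h7 : g = C (((n + 1 : ℕ) : ℂ)⁻¹) * (((n + 1 : ℕ) : R) * g) := by
      rw [← mul_assoc, ← C_eq_coe_nat, ← C_mul,
        inv_mul_cancel₀ (Nat.cast_ne_zero.2 (Nat.succ_ne_zero n)), C_1, one_mul]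
    have h8 := Ideal.mul_mem_left _ (C (((n + 1 : ℕ) : ℂ)⁻¹)) h6
    rwa [← h7] at h8
  have hK : Ideal.span {g, pderiv 0 g, pderiv 1 g} ⊔ 𝔪 ^ N =
      Ideal.span {pderiv 0 g, pderiv 1 g} ⊔ 𝔪 ^ (2 * n - 1) := by
    refine le_antisymm (sup_le ?_ ?_) (sup_le ?_ ?_)
    · rw [Ideal.span_insert, sup_le_iff]
      exact ⟨(Ideal.span_singleton_le_iff_mem _).2 hgmem, le_sup_left⟩
    · exact (Ideal.pow_le_pow_right (by omega)).trans le_sup_right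
    · exact (Ideal.span_mono (Set.subset_insert _ _)).trans le_sup_left
    · have h3 := pow_le_span_sup_pow hn h₁ h₂ hab (N - (2 * n - 1))
      rw [show 2 * n - 1 + (N - (2 * n - 1)) = N by omega] at h3
      exact h3.trans (sup_le_sup_right (Ideal.span_mono (Set.subset_insert _ _)) _)
  rw [hK, finrank_quotient_pair hn h₁ h₂ hab, Nat.add_sub_cancel]

end LocalDegree

/-! ### From the Hilbert function to an affine coordinate ring -/

section Affine

local notation "R" => MvPolynomial (Fin 2) ℂ

theorem eval_smul_of_isHomogeneous {σ : Type*} {F : MvPolynomial σ ℂ} {m : ℕ}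
    (hF : F.IsHomogeneous m) (c : ℂ) (w : σ → ℂ) : eval (c • w) F = c ^ m * eval w F := by
  rw [eval_eq, eval_eq, Finset.mul_sum]
  refine Finset.sum_congr rfl fun d hd => ?_
  simp only [Pi.smul_apply, smul_eq_mul, mul_pow, Finset.prod_mul_distrib, Finset.prod_pow_eq_pow_sum]
  rw [← hF.degree_eq_sum_deg_support hd]
  ring

theorem homogeneousComponent_mul_of_isHomogeneous {σ : Type*} {F G : MvPolynomial σ ℂ} {m : ℕ}
    (hF : F.IsHomogeneous m) (s : ℕ) :
    homogeneousComponent (m + s) (F * G) = F * homogeneousComponent s G := by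
  conv_lhs => rw [← sum_homogeneousComponent G, Finset.mul_sum, map_sum]
  rw [Finset.sum_eq_single s]
  · rw [homogeneousComponent_eq_self (hF.mul (homogeneousComponent_isHomogeneous s G))]
  · intro j _ hj
    rw [homogeneousComponent_of_mem (hF.mul (homogeneousComponent_isHomogeneous j G)), if_neg]
    omega
  · intro h
    rw [homogeneousComponent_eq_zero s G (by simpa [Nat.lt_succ_iff] using h), mul_zero, map_zero]

variable (α β : ℂ)

/-- The linear form `α x + β y + z`. -/
noncomputable def lineAtInfinity : S := C α * X 0 + C β * X 1 + X 2

/-- Restriction of a form to the affine chart `α x + β y + z = 1`, with coordinates `x` and `y`. -/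
noncomputable def dehomogenize : S →ₐ[ℂ] R :=
  aeval ![X 0, X 1, 1 - C α * X 0 - C β * X 1]

/-- The point of the chart `α x + β y + z = 1` with affine coordinates `a`. -/
def chartPoint (a : Fin 2 → ℂ) : Fin 3 → ℂ := ![a 0, a 1, 1 - α * a 0 - β * a 1]

theorem lineAtInfinity_isHomogeneous : (lineAtInfinity α β).IsHomogeneous 1 :=
  ((isHomogeneous_C_mul_X _ _).add (isHomogeneous_C_mul_X _ _)).add (isHomogeneous_X _ _)

theorem eval_lineAtInfinity (w : Fin 3 → ℂ) :
    eval w (lineAtInfinity α β) = α * w 0 + β * w 1 + w 2 := by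
  simp [lineAtInfinity]

theorem lineAtInfinity_ne_zero : lineAtInfinity α β ≠ 0 := by
  intro h
  have := eval_lineAtInfinity α β ![0, 0, 1]
  simp [h] at this

theorem dehomogenize_lineAtInfinity : dehomogenize α β (lineAtInfinity α β) = 1 := by
  simp [dehomogenize, lineAtInfinity, algebraMap_eq]

theorem dehomogenize_surjective : Function.Surjective (dehomogenize α β) := by
  intro p
  refine ⟨aeval ![X 0, X 1] p, ?_⟩
  have : (dehomogenize α β).comp (aeval ![X 0, X 1]) = AlgHom.id ℂ R := by
    ext i; fin_cases i <;> simp [dehomogenize]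
  exact DFunLike.congr_fun this p

theorem eval_dehomogenize (a : Fin 2 → ℂ) (F : S) :
    eval a (dehomogenize α β F) = eval (chartPoint α β a) F := by
  have : (aeval a).comp (dehomogenize α β) =
      (aeval (chartPoint α β a) : S →ₐ[ℂ] ℂ) := by
    ext i; fin_cases i <;> simp [dehomogenize, chartPoint]
  simpa [aeval_eq_eval] using DFunLike.congr_fun this F

theorem smul_chartPoint {w : Fin 3 → ℂ} (hw : α * w 0 + β * w 1 + w 2 ≠ 0) :
    (α * w 0 + β * w 1 + w 2) • chartPoint α β
      ((α * w 0 + β * w 1 + w 2)⁻¹ • ![w 0, w 1]) = w := by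
  ext i
  fin_cases i <;> simp [chartPoint] <;> field_simp
  ring

variable {α β}

/-- Off the line at infinity every vector is a multiple of a chart point, so the product of `F` with
the equation of that line vanishes everywhere. -/
theorem eq_zero_of_dehomogenize_eq_zero {F : S} {s : ℕ} (hF : F.IsHomogeneous s)
    (h : dehomogenize α β F = 0) : F = 0 := by
  have h1 : lineAtInfinity α β * F = 0 := by
    refine MvPolynomial.funext fun w => ?_
    rw [map_mul, eval_lineAtInfinity, map_zero, mul_eq_zero, or_iff_not_imp_left]
    intro hw
    rw [← smul_chartPoint α β hw, eval_smul_of_isHomogeneous hF, ← eval_dehomogenize, h, map_zero, mul_zero]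
  exact (mul_eq_zero.1 h1).resolve_left (lineAtInfinity_ne_zero α β)

variable {J : Ideal S} {n : ℕ}

/-- Nullstellensatz: the scheme has no point on the line at infinity. -/
theorem exists_pow_le_sup (hV : ∀ w : Fin 3 → ℂ, (∀ p ∈ J, eval w p = 0) →
    α * w 0 + β * w 1 + w 2 = 0 → w = 0) :
    ∃ N, idealOfVars (Fin 3) ℂ ^ N ≤ J ⊔ Ideal.span {lineAtInfinity α β} := by
  refine Ideal.exists_pow_le_of_le_radical_of_fg ?_ (IsNoetherian.noetherian _)
  rw [← vanishingIdeal_zeroLocus_eq_radical (K := ℂ), idealOfVars, Ideal.span_le]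
  rintro _ ⟨i, rfl⟩ w hw
  have h0 : w = 0 := by
    refine hV w (fun p hp => ?_) ?_
    · simpa [aeval_eq_eval] using hw p (Ideal.mem_sup_left hp)
    · have := hw _ (Ideal.mem_sup_right (Ideal.mem_span_singleton_self _))
      rwa [aeval_eq_eval, eval_lineAtInfinity] at this
  simp [h0]

/-- In high degree, multiplication by the equation of the line at infinity maps each graded piece of
`S / J` onto the next one. -/
theorem exists_sub_mul_mem (hJ : ∀ p ∈ J, ∀ s, homogeneousComponent s p ∈ J)
    {N : ℕ} (hN : idealOfVars (Fin 3) ℂ ^ N ≤ J ⊔ Ideal.span {lineAtInfinity α β})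
    {s : ℕ} (hs : N ≤ s) {F : S} (hF : F.IsHomogeneous (s + 1)) :
    ∃ F' : S, F'.IsHomogeneous s ∧ F - lineAtInfinity α β * F' ∈ J := by
  obtain ⟨j, hj, k, hk, h⟩ := Submodule.mem_sup.1
    (hN (Ideal.pow_le_pow_right (by omega) (isHomogeneous_mem_pow hF)))
  obtain ⟨q, rfl⟩ := Ideal.mem_span_singleton.1 hk
  refine ⟨homogeneousComponent s q, homogeneousComponent_isHomogeneous _ _, ?_⟩
  have h1 := congrArg (homogeneousComponent (s + 1)) h
  rw [homogeneousComponent_eq_self hF, map_add, add_comm s 1,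
    homogeneousComponent_mul_of_isHomogeneous (lineAtInfinity_isHomogeneous α β)] at h1
  rw [← h1, add_sub_cancel_right]
  exact hJ j hj _

/-- The degree of a zero-dimensional subscheme of the plane is the dimension of the coordinate
ring of its affine part, if no point of it lies at infinity. -/
theorem finrank_quotient_map_dehomogenize (hJ : ∀ p ∈ J, ∀ s, homogeneousComponent s p ∈ J)
    (hdeg : HasDegree J n) (hV : ∀ w : Fin 3 → ℂ, (∀ p ∈ J, eval w p = 0) →
      α * w 0 + β * w 1 + w 2 = 0 → w = 0) :
    Module.finrank ℂ (R ⧸ J.map (dehomogenize α β)) = n := by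
  obtain ⟨N, hN⟩ := exists_pow_le_sup hV
  obtain ⟨M, hM⟩ := eventually_atTop.1 hdeg
  set L := lineAtInfinity α β with hL
  let H := homogeneousSubmodule (Fin 3) ℂ
  let P : ∀ s, Submodule ℂ (H s) := fun s => (J.restrictScalars ℂ).comap (H s).subtype
  have hmulmem : ∀ s (F : H s), L * F.1 ∈ H (s + 1) := fun s F => by
    have := (lineAtInfinity_isHomogeneous α β).mul F.2
    rwa [add_comm] at this
  let μ : ∀ s, H s →ₗ[ℂ] H (s + 1) := fun s =>
    { toFun := fun F => ⟨L * F.1, hmulmem s F⟩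
      map_add' := fun x y => by ext1; simp [mul_add]
      map_smul' := fun r x => by ext1; simp }
  have hμP : ∀ s, P s ≤ (P (s + 1)).comap (μ s) := fun s F hF => J.mul_mem_left L hF
  -- In these degrees multiplication by `L` is a surjection between spaces of the same dimension
  -- `n`, hence injective.
  have hcancel : ∀ s, N + M ≤ s → ∀ F : S, F.IsHomogeneous s → L * F ∈ J → F ∈ J := by
    intro s hs F hF h
    have hsurj : Function.Surjective ((P s).mapQ (P (s + 1)) (μ s) (hμP s)) := by
      intro y
      obtain ⟨G, rfl⟩ := Submodule.Quotient.mk_surjective _ y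
      obtain ⟨F', hF', hG⟩ := exists_sub_mul_mem hJ hN (by omega : N ≤ s) G.2
      refine ⟨Submodule.Quotient.mk ⟨F', hF'⟩, ?_⟩
      rw [Submodule.mapQ_apply, eq_comm, Submodule.Quotient.eq]
      exact hG
    have hfr : Module.finrank ℂ (H s ⧸ P s) = Module.finrank ℂ (H (s + 1) ⧸ P (s + 1)) :=
      (hM s (by omega)).trans (hM (s + 1) (by omega)).symm
    have hinj := (LinearMap.injective_iff_surjective_of_finrank_eq_finrank hfr).2 hsurj
    have h0 : (Submodule.Quotient.mk ⟨F, hF⟩ : H s ⧸ P s) = 0 := by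
      refine hinj ?_
      rw [map_zero, Submodule.mapQ_apply, Submodule.Quotient.mk_eq_zero]
      exact h
    exact (Submodule.Quotient.mk_eq_zero (P s)).1 h0
  have hcancel_pow : ∀ k s, N + M ≤ s → ∀ F : S, F.IsHomogeneous s → L ^ k * F ∈ J → F ∈ J := by
    intro k
    induction k with
    | zero => intro s _ F _ h; simpa using h
    | succ k ih =>
      intro s hs F hF h
      refine hcancel s hs F hF (ih (s + 1) (by omega) _ (hmulmem s ⟨F, hF⟩) ?_)
      rwa [pow_succ, mul_assoc] at h
  set s := N + M with hs
  have hφL : dehomogenize α β L = 1 := dehomogenize_lineAtInfinity α β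
  have hφmem : ∀ F ∈ J, dehomogenize α β F ∈ J.map (dehomogenize α β) := fun F hF =>
    Ideal.mem_map_of_mem _ hF
  let Ψ : H s →ₗ[ℂ] (R ⧸ J.map (dehomogenize α β)) :=
    (Ideal.Quotient.mkₐ ℂ (J.map (dehomogenize α β))).toLinearMap ∘ₗ
      (dehomogenize α β).toLinearMap ∘ₗ (H s).subtype
  have hΨ : ∀ F : H s, Ψ F = Ideal.Quotient.mk _ (dehomogenize α β F.1) := fun F => rfl
  have hhigh : ∀ k (F : S), F.IsHomogeneous (s + k) →
      ∃ F' : S, F'.IsHomogeneous s ∧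
        dehomogenize α β F - dehomogenize α β F' ∈ J.map (dehomogenize α β) := by
    intro k
    induction k with
    | zero => intro F hF; exact ⟨F, hF, by simp⟩
    | succ k ih =>
      intro F hF
      obtain ⟨F₁, hF₁, h₁⟩ := exists_sub_mul_mem hJ hN (by omega : N ≤ s + k) hF
      obtain ⟨F₂, hF₂, h₂⟩ := ih F₁ hF₁
      refine ⟨F₂, hF₂, ?_⟩
      have h3 := hφmem _ h₁
      rw [map_sub, map_mul, ← hL, hφL, one_mul] at h3
      simpa using add_mem h3 h₂
  have hrange : ∀ j (F : S), F.IsHomogeneous j →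
      Ideal.Quotient.mk (J.map (dehomogenize α β)) (dehomogenize α β F) ∈ LinearMap.range Ψ := by
    intro j F hF
    rcases le_total j s with hj | hj
    · have h1 : (L ^ (s - j) * F).IsHomogeneous s := by
        have := ((lineAtInfinity_isHomogeneous α β).pow (s - j)).mul hF
        rwa [one_mul, Nat.sub_add_cancel hj] at this
      refine ⟨⟨_, h1⟩, ?_⟩
      rw [hΨ, map_mul, map_pow, hφL, one_pow, one_mul]
    · obtain ⟨k, rfl⟩ := Nat.exists_eq_add_of_le hj
      obtain ⟨F', hF', h⟩ := hhigh k F hF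
      exact ⟨⟨F', hF'⟩, by rw [hΨ, eq_comm]; exact Ideal.Quotient.eq.2 h⟩
  have hsurj : Function.Surjective Ψ := by
    rw [← LinearMap.range_eq_top, eq_top_iff]
    rintro y -
    obtain ⟨p, rfl⟩ := Ideal.Quotient.mk_surjective y
    obtain ⟨F, rfl⟩ := dehomogenize_surjective α β p
    rw [← sum_homogeneousComponent F, map_sum, map_sum]
    exact sum_mem fun j _ => hrange j _ (homogeneousComponent_isHomogeneous j F)
  have hker : LinearMap.ker Ψ = P s := by
    ext F
    rw [LinearMap.mem_ker, hΨ, Ideal.Quotient.eq_zero_iff_mem]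
    refine ⟨fun h => ?_, fun h => hφmem _ h⟩
    obtain ⟨j, hj, hjF⟩ := (Ideal.mem_map_iff_of_surjective (dehomogenize α β)
      (dehomogenize_surjective α β)).1 h
    set T := s + j.totalDegree with hT
    -- `G` homogenizes `j` by powers of `L`. It lies in `J` because `J` contains the homogeneous
    -- parts of `j`; it equals `L ^ (T - s) * F`, from which `L` can be cancelled.
    set G : S := ∑ i ∈ Finset.range (j.totalDegree + 1), L ^ (T - i) * homogeneousComponent i j
    have hGJ : G ∈ J := sum_mem fun i _ => J.mul_mem_left _ (hJ j hj i)
    have hGφ : dehomogenize α β G = dehomogenize α β j := by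
      conv_rhs => rw [← sum_homogeneousComponent j]
      rw [map_sum, map_sum]
      exact Finset.sum_congr rfl fun i _ => by rw [map_mul, map_pow, hφL, one_pow, one_mul]
    have hGh : G.IsHomogeneous T := by
      refine IsHomogeneous.sum _ _ _ fun i hi => ?_
      have hi' := Finset.mem_range.1 hi
      have := ((lineAtInfinity_isHomogeneous α β).pow (T - i)).mul
        (homogeneousComponent_isHomogeneous i j)
      rwa [one_mul, Nat.sub_add_cancel (by omega)] at this
    have hFh : (L ^ (T - s) * F.1).IsHomogeneous T := by
      have := ((lineAtInfinity_isHomogeneous α β).pow (T - s)).mul F.2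
      rwa [one_mul, Nat.sub_add_cancel (by omega)] at this
    have h0 := eq_zero_of_dehomogenize_eq_zero (α := α) (β := β) (hFh.sub hGh) (by
      rw [map_sub, map_mul, map_pow, hφL, one_pow, one_mul, hGφ, hjF, sub_self])
    rw [sub_eq_zero] at h0
    exact hcancel_pow (T - s) s le_rfl F.1 F.2 (h0 ▸ hGJ)
  rw [← hM s (by omega), hilbertFunction]
  change _ = Module.finrank ℂ (H s ⧸ P s)
  rw [← hker]
  exact (Ψ.quotKerEquivOfSurjective hsurj).finrank_eq.symm

end Affine

/-! ### Decomposition into local rings -/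

section ChineseRemainder

variable {σ : Type*} [Finite σ]

/-- The coordinate ring of a zero-dimensional affine scheme is the product of its local rings. -/
theorem finrank_quotient_eq_sum {K : Ideal (MvPolynomial σ ℂ)} {Z : Finset (σ → ℂ)}
    (hZ : ∀ a, (∀ p ∈ K, eval a p = 0) → a ∈ Z) :
    ∃ N₀, ∀ N ≥ N₀, (∀ a ∈ Z, Module.Finite ℂ
        (MvPolynomial σ ℂ ⧸ (K ⊔ vanishingIdeal ℂ {a} ^ N))) →
      Module.finrank ℂ (MvPolynomial σ ℂ ⧸ K) =
        ∑ a ∈ Z, Module.finrank ℂ (MvPolynomial σ ℂ ⧸ (K ⊔ vanishingIdeal ℂ {a} ^ N)) := by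
  classical
  let 𝔫 : (σ → ℂ) → Ideal (MvPolynomial σ ℂ) := fun a => vanishingIdeal ℂ {a}
  have hprod : ∏ a ∈ Z, 𝔫 a ≤ K.radical := by
    rw [← vanishingIdeal_zeroLocus_eq_radical (K := ℂ)]
    intro p hp a ha
    have haZ : a ∈ Z := hZ a fun q hq => by simpa [aeval_eq_eval] using ha q hq
    exact (Ideal.prod_le_inf.trans (Finset.inf_le haZ)) hp a rfl
  obtain ⟨N₀, hN₀⟩ := Ideal.exists_pow_le_of_le_radical_of_fg hprod (IsNoetherian.noetherian _)
  refine ⟨N₀, fun N hN hfin => ?_⟩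
  let I : Z → Ideal (MvPolynomial σ ℂ) := fun a => K ⊔ 𝔫 a ^ N
  have hcop : Pairwise (Function.onFun IsCoprime I) := by
    intro a b hab
    have hne : 𝔫 a ≠ 𝔫 b := by
      intro h
      refine hab (Subtype.ext (_root_.funext fun i => ?_))
      have h1 : (X i - C (a.1 i) : MvPolynomial σ ℂ) ∈ 𝔫 a := by
        rw [mem_vanishingIdeal_singleton_iff]; simp
      rw [h, mem_vanishingIdeal_singleton_iff] at h1
      have h4 : b.1 i - a.1 i = 0 := by simpa using h1
      exact (sub_eq_zero.1 h4).symm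
    have h2 : IsCoprime (𝔫 a) (𝔫 b) := Ideal.isCoprime_of_isMaximal hne
    have h3 : IsCoprime (𝔫 a ^ N) (𝔫 b ^ N) := h2.pow
    rw [Ideal.isCoprime_iff_sup_eq] at h3
    change IsCoprime (I a) (I b)
    rw [Ideal.isCoprime_iff_sup_eq, eq_top_iff, ← h3]
    exact sup_le_sup le_sup_right le_sup_right
  have hinf : ⨅ a, I a = K := by
    refine le_antisymm ?_ (le_iInf fun a => le_sup_left)
    have h1 := Ideal.prod_eq_iInf_of_pairwise_isCoprime (s := (Finset.univ : Finset Z)) (J := I)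
      fun a _ b _ hab => hcop hab
    simp only [Finset.mem_univ, iInf_pos] at h1
    rw [← h1]
    -- The product of the ideals `I a` lies in `K` plus the product of the `𝔫 a ^ N`; the latter is
    -- inside `K` for `N ≥ N₀`.
    have h2 : ∀ T : Finset Z, ∏ a ∈ T, I a ≤ K ⊔ ∏ a ∈ T, 𝔫 a ^ N := by
      intro T
      induction T using Finset.induction_on with
      | empty => simp
      | insert a T ha ih =>
        rw [Finset.prod_insert ha, Finset.prod_insert ha]
        refine (Ideal.mul_mono_right ih).trans ?_
        change (K ⊔ 𝔫 a ^ N) * _ ≤ _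
        rw [Ideal.sup_mul, Ideal.mul_sup (𝔫 a ^ N)]
        exact sup_le (Ideal.mul_le_left.trans le_sup_left)
          (sup_le (Ideal.mul_le_right.trans le_sup_left) le_sup_right)
    refine (h2 _).trans (sup_le le_rfl ?_)
    rw [Finset.prod_pow, Finset.univ_eq_attach, Finset.prod_attach Z 𝔫]
    exact (Ideal.pow_le_pow_right hN).trans hN₀
  let Φ : MvPolynomial σ ℂ →ₗ[ℂ] ∀ a, MvPolynomial σ ℂ ⧸ I a :=
    LinearMap.pi fun a => (Ideal.Quotient.mkₐ ℂ (I a)).toLinearMap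
  have hsurj : Function.Surjective Φ := fun x => by
    obtain ⟨r, hr⟩ := Ideal.pi_quotient_surjective hcop x
    exact ⟨r, _root_.funext hr⟩
  have hker : LinearMap.ker Φ = K.restrictScalars ℂ := by
    ext p
    rw [LinearMap.mem_ker, Submodule.restrictScalars_mem, ← hinf, Ideal.mem_iInf, _root_.funext_iff]
    exact forall_congr' fun a => Ideal.Quotient.eq_zero_iff_mem
  have hfr := (Φ.quotKerEquivOfSurjective hsurj).finrank_eq
  rw [hker] at hfr
  have hfin' : ∀ a : Z, Module.Finite ℂ (MvPolynomial σ ℂ ⧸ I a) := fun a => hfin a a.2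
  rw [Module.finrank_pi_fintype] at hfr
  refine Eq.trans ?_ (hfr.trans ?_)
  · rfl
  · exact Finset.sum_coe_sort Z fun a =>
      Module.finrank ℂ (MvPolynomial σ ℂ ⧸ (K ⊔ vanishingIdeal ℂ {a} ^ N))

end ChineseRemainder

/-! ### Moving a point to the origin -/

section Translate

theorem pderiv_aeval {σ τ : Type*} [Fintype σ] (L : σ → MvPolynomial τ ℂ) (i : τ)
    (F : MvPolynomial σ ℂ) :
    pderiv i (aeval L F) = ∑ j, aeval L (pderiv j F) * pderiv i (L j) := by
  classical
  induction F using MvPolynomial.induction_on with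
  | C a => simp
  | add p q hp hq => simp only [map_add, hp, hq, add_mul, Finset.sum_add_distrib]
  | mul_X p k hp =>
    have h : ∀ j, aeval L (pderiv j (p * X k)) * pderiv i (L j) =
        aeval L (pderiv j p) * pderiv i (L j) * L k +
          aeval L p * (aeval L (pderiv j (X k)) * pderiv i (L j)) := fun j => by
      rw [pderiv_mul, map_add, map_mul, map_mul, aeval_X]; ring
    have hk : ∑ j, aeval L (pderiv j (X k : MvPolynomial σ ℂ)) * pderiv i (L j) =
        pderiv i (L k) := by
      rw [Finset.sum_eq_single k]
      · rw [pderiv_X_self, map_one, one_mul]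
      · intro j _ hj; rw [pderiv_X_of_ne hj.symm, map_zero, zero_mul]
      · simp
    rw [map_mul, pderiv_mul, aeval_X, hp, Finset.sum_congr rfl fun j _ => h j,
      Finset.sum_add_distrib, ← Finset.sum_mul, ← Finset.mul_sum, hk]

local notation "R" => MvPolynomial (Fin 2) ℂ
local notation "𝔪" => idealOfVars (Fin 2) ℂ

/-- The translation `p(X) ↦ p(X + a)`. -/
noncomputable def translate (a : Fin 2 → ℂ) : R ≃ₐ[ℂ] R :=
  AlgEquiv.ofAlgHom (aeval fun i => X i + C (a i)) (aeval fun i => X i - C (a i))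
    (by ext i; simp [algebraMap_eq]) (by ext i; simp [algebraMap_eq])

theorem translate_apply (a : Fin 2 → ℂ) (p : R) :
    translate a p = aeval (fun i => X i + C (a i)) p := rfl

theorem pderiv_translate (a : Fin 2 → ℂ) (i : Fin 2) (p : R) :
    pderiv i (translate a p) = translate a (pderiv i p) := by
  classical
  rw [translate_apply, pderiv_aeval, Finset.sum_eq_single i]
  · simp [translate_apply]
  · intro j _ hj; simp [pderiv_X, Pi.single_eq_of_ne hj]
  · simp

theorem eval_zero_translate (a : Fin 2 → ℂ) (p : R) : eval 0 (translate a p) = eval a p := by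
  have : (aeval (0 : Fin 2 → ℂ)).comp (translate a : R →ₐ[ℂ] R) =
      (aeval a : R →ₐ[ℂ] ℂ) := by
    ext i; simp [translate_apply]
  simpa [aeval_eq_eval] using DFunLike.congr_fun this p

theorem mem_idealOfVars_iff_eval_zero {p : R} : p ∈ 𝔪 ↔ eval 0 p = 0 := by
  rw [← pow_one 𝔪, mem_pow_idealOfVars_iff', eval_zero, constantCoeff_eq]
  constructor
  · intro h; exact h 0 (by simp)
  · intro h d hd
    rw [Nat.lt_one_iff, Finsupp.degree_eq_zero_iff] at hd
    rw [hd, h]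

theorem map_translate_vanishingIdeal (a : Fin 2 → ℂ) :
    (vanishingIdeal ℂ {a} : Ideal R).map (translate a) = 𝔪 := by
  ext q
  rw [Ideal.mem_map_iff_of_surjective (translate a) (translate a).surjective,
    mem_idealOfVars_iff_eval_zero]
  constructor
  · rintro ⟨p, hp, rfl⟩
    rw [mem_vanishingIdeal_singleton_iff] at hp
    rwa [eval_zero_translate, ← aeval_eq_eval]
  · intro h
    refine ⟨(translate a).symm q, ?_, by simp⟩
    rw [mem_vanishingIdeal_singleton_iff, aeval_eq_eval]
    change eval a _ = 0
    rw [← eval_zero_translate, AlgEquiv.apply_symm_apply, h]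

/-- The Tjurina number at `a` of a curve which is ordinary at `a`. -/
theorem finrank_tjurina_at {g G : R} (a : Fin 2 → ℂ) {m : ℕ} (hm : 2 ≤ m) (hm' : m ≤ 4)
    (hg : HasLowestForm (translate a g) m G) (hG : Squarefree G) {N : ℕ} (hN : 2 * m - 3 ≤ N) :
    Module.finrank ℂ (R ⧸ (Ideal.span {g, pderiv 0 g, pderiv 1 g} ⊔ vanishingIdeal ℂ {a} ^ N)) =
      (m - 1) ^ 2 := by
  rw [← finrank_tjurina hm hm' hg hG hN]
  refine (Ideal.quotientEquivAlg _ _ (translate a) ?_).toLinearEquiv.finrank_eq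
  change _ = Ideal.map (translate a) _
  rw [Ideal.map_sup, Ideal.map_pow, map_translate_vanishingIdeal, Ideal.map_span,
    Set.image_insert_eq, Set.image_pair, pderiv_translate, pderiv_translate]

end Translate

/-! ### The Jacobian ideal in an affine chart -/

section Degree

local notation "R" => MvPolynomial (Fin 2) ℂ

variable {α β : ℂ} {f : S} {e n : ℕ}

theorem jacobianIdeal_homogeneousComponent_mem (hf : f.IsHomogeneous e) {p : S}
    (hp : p ∈ jacobianIdeal f) (s : ℕ) : homogeneousComponent s p ∈ jacobianIdeal f := by
  let _ : GradedAlgebra (homogeneousSubmodule (Fin 3) ℂ) := MvPolynomial.gradedAlgebra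
  refine homogeneousComponent_mem_of_mem ?_ hp s
  refine Ideal.homogeneous_span _ _ ?_
  rintro _ ⟨i, rfl⟩
  exact ⟨e - 1, hf.pderiv⟩

theorem pderiv_zero_dehomogenize (f : S) : pderiv 0 (dehomogenize α β f) =
    dehomogenize α β (pderiv 0 f) - C α * dehomogenize α β (pderiv 2 f) := by
  rw [dehomogenize, pderiv_aeval, Fin.sum_univ_three]
  simp [pderiv_X]
  ring

theorem pderiv_one_dehomogenize (f : S) : pderiv 1 (dehomogenize α β f) =
    dehomogenize α β (pderiv 1 f) - C β * dehomogenize α β (pderiv 2 f) := by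
  rw [dehomogenize, pderiv_aeval, Fin.sum_univ_three]
  simp [pderiv_X]
  ring

/-- Euler's relation with `z = 1 - αx - βy`, regrouped by the chain rule. It recovers the third
partial derivative from the affine equation and its two derivatives. -/
theorem dehomogenize_pderiv_two (hf : f.IsHomogeneous e) : dehomogenize α β (pderiv 2 f) =
    C (e : ℂ) * dehomogenize α β f - X 0 * pderiv 0 (dehomogenize α β f) -
      X 1 * pderiv 1 (dehomogenize α β f) := by
  have h := congrArg (dehomogenize α β) hf.sum_X_mul_pderiv
  have h0 : dehomogenize α β (X 0) = X 0 := by simp [dehomogenize]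
  have h1 : dehomogenize α β (X 1) = X 1 := by simp [dehomogenize]
  have h2 : dehomogenize α β (X 2) = 1 - C α * X 0 - C β * X 1 := by simp [dehomogenize]
  rw [Fin.sum_univ_three, map_add, map_add, map_mul, map_mul, map_mul, h0, h1, h2, nsmul_eq_mul,
    map_mul, map_natCast] at h
  rw [pderiv_zero_dehomogenize, pderiv_one_dehomogenize, C_eq_coe_nat]
  linear_combination h

theorem map_dehomogenize_jacobianIdeal (hf : f.IsHomogeneous e) (he : e ≠ 0) :
    (jacobianIdeal f).map (dehomogenize α β) = Ideal.span {dehomogenize α β f,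
      pderiv 0 (dehomogenize α β f), pderiv 1 (dehomogenize α β f)} := by
  set g := dehomogenize α β f with hg
  have h2 := dehomogenize_pderiv_two (α := α) (β := β) hf
  have h0 := pderiv_zero_dehomogenize (α := α) (β := β) f
  have h1 := pderiv_one_dehomogenize (α := α) (β := β) f
  rw [← hg] at h0 h1 h2
  rw [jacobianIdeal, Ideal.map_span]
  refine le_antisymm (Ideal.span_le.2 ?_) (Ideal.span_le.2 ?_)
  · set K := Ideal.span {g, pderiv 0 g, pderiv 1 g} with hK
    have m0 : g ∈ K := Ideal.subset_span (by simp)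
    have m1 : pderiv 0 g ∈ K := Ideal.subset_span (by simp)
    have m2 : pderiv 1 g ∈ K := Ideal.subset_span (by simp)
    have k2 : dehomogenize α β (pderiv 2 f) ∈ K := by
      rw [h2]
      exact sub_mem (sub_mem (K.mul_mem_left _ m0) (K.mul_mem_left _ m1)) (K.mul_mem_left _ m2)
    rintro _ ⟨_, ⟨i, rfl⟩, rfl⟩
    fin_cases i
    · have := add_mem m1 (K.mul_mem_left (C α) k2)
      rw [h0, sub_add_cancel] at this
      exact this
    · have := add_mem m2 (K.mul_mem_left (C β) k2)
      rw [h1, sub_add_cancel] at this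
      exact this
    · exact k2
  · set K := Ideal.span (dehomogenize α β '' Set.range fun i : Fin 3 => pderiv i f) with hK
    have k : ∀ i, dehomogenize α β (pderiv i f) ∈ K := fun i =>
      Ideal.subset_span ⟨_, ⟨i, rfl⟩, rfl⟩
    have m1 : pderiv 0 g ∈ K := h0 ▸ sub_mem (k 0) (K.mul_mem_left _ (k 2))
    have m2 : pderiv 1 g ∈ K := h1 ▸ sub_mem (k 1) (K.mul_mem_left _ (k 2))
    have m0 : g ∈ K := by
      have h3 : g = C ((e : ℂ)⁻¹) * (dehomogenize α β (pderiv 2 f) + X 0 * pderiv 0 g +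
          X 1 * pderiv 1 g) := by
        have h4 : ∀ u v w : R, u - v - w + v + w = u := fun u v w => by ring
        rw [h2, h4, ← mul_assoc, ← C_mul, inv_mul_cancel₀ (by exact_mod_cast he), C_1, one_mul]
      have h4 := K.mul_mem_left (C ((e : ℂ)⁻¹))
        (add_mem (add_mem (k 2) (K.mul_mem_left (X 0) m1)) (K.mul_mem_left (X 1) m2))
      rwa [← h3] at h4
    rintro _ (rfl | rfl | rfl)
    · exact m0
    · exact m1
    · exact m2

/-- The degree of the Jacobian ideal of a plane curve with ordinary singularities of multiplicity
at most `4` is the sum of its Tjurina numbers. -/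
theorem degree_jacobianIdeal_eq_sum (hf : f.IsHomogeneous e) (he : e ≠ 0)
    (hdeg : HasDegree (jacobianIdeal f) n)
    (hV : ∀ w : Fin 3 → ℂ, (∀ i, eval w (pderiv i f) = 0) → α * w 0 + β * w 1 + w 2 = 0 → w = 0)
    (Z : Finset (Fin 2 → ℂ))
    (hZ : ∀ a, (∀ i, eval (chartPoint α β a) (pderiv i f) = 0) → a ∈ Z) (m : (Fin 2 → ℂ) → ℕ)
    (hm : ∀ a ∈ Z, 2 ≤ m a ∧ m a ≤ 4 ∧
      ∃ G, HasLowestForm (translate a (dehomogenize α β f)) (m a) G ∧ Squarefree G) :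
    n = ∑ a ∈ Z, (m a - 1) ^ 2 := by
  have hmem : ∀ i, pderiv i f ∈ jacobianIdeal f := fun i => Ideal.subset_span ⟨i, rfl⟩
  have h1 := finrank_quotient_map_dehomogenize (α := α) (β := β)
    (fun p hp s => jacobianIdeal_homogeneousComponent_mem hf hp s) hdeg
    (fun w hw => hV w fun i => hw _ (hmem i))
  obtain ⟨N₀, hN₀⟩ := finrank_quotient_eq_sum (Z := Z)
    (K := (jacobianIdeal f).map (dehomogenize α β)) (fun a ha => hZ a fun i => by
      rw [← eval_dehomogenize]
      exact ha _ (Ideal.mem_map_of_mem _ (hmem i)))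
  -- The exponent must be at least `N₀` for the decomposition and at least `2 * 4 - 3 = 5` for the
  -- local computation.
  have hloc : ∀ a ∈ Z, Module.finrank ℂ (R ⧸ ((jacobianIdeal f).map (dehomogenize α β) ⊔
      vanishingIdeal ℂ {a} ^ (N₀ + 5))) = (m a - 1) ^ 2 := by
    intro a ha
    obtain ⟨h2, h4, G, hG, hsq⟩ := hm a ha
    rw [map_dehomogenize_jacobianIdeal hf he]
    exact finrank_tjurina_at a h2 h4 hG hsq (by omega)
  rw [← h1, hN₀ (N₀ + 5) (by omega)]
  · exact Finset.sum_congr rfl hloc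
  · intro a ha
    refine Module.finite_of_finrank_pos ?_
    rw [hloc a ha]
    have := (hm a ha).1
    exact pow_pos (by omega) 2

end Degree

/-! ### First-order expansion of a form at a point -/

section Tangent

variable {F : S} {e : ℕ}

theorem vanishes_mk (hF : F.IsHomogeneous e) {w : Fin 3 → ℂ} (hw : w ≠ 0) :
    Vanishes F (Projectivization.mk ℂ w hw) ↔ eval w F = 0 := by
  obtain ⟨a, ha⟩ := Projectivization.exists_smul_eq_mk_rep ℂ w hw
  rw [Vanishes, ← ha, Units.smul_def, eval_smul_of_isHomogeneous hF, mul_eq_zero,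
    or_iff_right (pow_ne_zero _ a.ne_zero)]

/-- The linear part `∑ᵢ ∂ᵢF(w) Xᵢ` of `F` at `w`. -/
noncomputable def tangentForm (F : S) (w : Fin 3 → ℂ) : S :=
  ∑ i, C (eval w (pderiv i F)) * X i

theorem tangentForm_isHomogeneous (F : S) (w : Fin 3 → ℂ) : (tangentForm F w).IsHomogeneous 1 :=
  IsHomogeneous.sum _ _ _ fun i _ => isHomogeneous_C_mul_X _ i

theorem eval_tangentForm (F : S) (w v : Fin 3 → ℂ) :
    eval v (tangentForm F w) = ∑ i, v i * eval w (pderiv i F) := by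
  simp [tangentForm, mul_comm]

theorem eval_self_tangentForm (hF : F.IsHomogeneous e) (w : Fin 3 → ℂ) :
    eval w (tangentForm F w) = e * eval w F := by
  have := congrArg (eval w) hF.sum_X_mul_pderiv
  simpa [eval_tangentForm] using this

theorem tangentForm_eq_zero_iff (F : S) (w : Fin 3 → ℂ) :
    tangentForm F w = 0 ↔ ∀ i, eval w (pderiv i F) = 0 := by
  constructor
  · intro h i
    have := eval_tangentForm F w (Pi.single i 1)
    rw [h, Finset.sum_eq_single i (fun j _ hj => by rw [Pi.single_eq_of_ne hj, zero_mul])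
      (by simp)] at this
    simpa using this.symm
  · intro h
    simp [tangentForm, h]

theorem tangentForm_eq_self (hF : F.IsHomogeneous 1) (w : Fin 3 → ℂ) : tangentForm F w = F := by
  have h := hF.sum_X_mul_pderiv
  rw [one_smul] at h
  conv_rhs => rw [← h]
  refine Finset.sum_congr rfl fun i _ => ?_
  have h0 : (pderiv i F).totalDegree = 0 :=
    (totalDegree_zero_iff_isHomogeneous _).2 (by simpa using hF.pderiv (i := i))
  rw [totalDegree_eq_zero_iff_eq_C] at h0
  rw [h0, eval_C, mul_comm]

theorem tangentForm_smul (hF : F.IsHomogeneous e) (c : ℂ) (w : Fin 3 → ℂ) :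
    tangentForm F (c • w) = C (c ^ (e - 1)) * tangentForm F w := by
  simp only [tangentForm, Finset.mul_sum, eval_smul_of_isHomogeneous hF.pderiv, C_mul, mul_assoc]

theorem expandAt_sub_mem (F : S) (w : Fin 3 → ℂ) :
    expandAt F w - C (eval w F) - tangentForm F w ∈ idealOfVars (Fin 3) ℂ ^ 2 := by
  induction F using MvPolynomial.induction_on with
  | C a => simp [expandAt, tangentForm, algebraMap_eq]
  | add p q hp hq =>
    have h : tangentForm (p + q) w = tangentForm p w + tangentForm q w := by
      simp [tangentForm, add_mul, Finset.sum_add_distrib]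
    have h' : expandAt (p + q) w = expandAt p w + expandAt q w := map_add _ _ _
    have := add_mem hp hq
    rw [h, h', map_add, C_add]
    convert this using 1
    ring
  | mul_X p k hp =>
    have h : tangentForm (p * X k) w = C (w k) * tangentForm p w + C (eval w p) * X k := by
      have h1 : ∀ i, C (eval w (pderiv i (p * X k))) * X i = C (w k) *
          (C (eval w (pderiv i p)) * X i) +
          C (eval w p) * (C (eval w (pderiv i (X k : S))) * X i) := fun i => by
        rw [pderiv_mul, map_add, map_mul, map_mul, eval_X, C_add, C_mul, C_mul]; ring
      have h2 : ∑ i, C (eval w (pderiv i (X k : S))) * X i = (X k : S) := by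
        rw [Finset.sum_eq_single k]
        · simp
        · intro j _ hj; rw [pderiv_X_of_ne hj.symm]; simp
        · simp
      rw [tangentForm, Finset.sum_congr rfl fun i _ => h1 i, Finset.sum_add_distrib,
        ← Finset.mul_sum, ← Finset.mul_sum, h2, tangentForm]
    have h' : expandAt (p * X k) w = expandAt p w * (X k + C (w k)) := by
      rw [expandAt, map_mul, aeval_X, expandAt]
    have h3 := Ideal.mul_mem_right (X k + C (w k)) _ hp
    have h4 := Ideal.mul_mem_mul (isHomogeneous_mem_pow (tangentForm_isHomogeneous p w))
      (isHomogeneous_mem_pow (isHomogeneous_X ℂ k))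
    rw [← pow_add] at h4
    rw [h, h', map_mul, eval_X, C_mul]
    have := add_mem h3 h4
    convert this using 1
    ring

/-- The lowest form at `w` of a curve which is smooth there or does not pass through it. -/
noncomputable def simpleLowestForm (F : S) (w : Fin 3 → ℂ) : S :=
  open Classical in if eval w F = 0 then tangentForm F w else C (eval w F)

open Classical in
theorem hasLowestForm_expandAt (F : S) (w : Fin 3 → ℂ) :
    HasLowestForm (expandAt F w) (if eval w F = 0 then 1 else 0) (simpleLowestForm F w) := by
  have h := expandAt_sub_mem F w
  by_cases hF : eval w F = 0
  · rw [if_pos hF, simpleLowestForm, if_pos hF]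
    refine ⟨tangentForm_isHomogeneous F w, ?_⟩
    simpa [hF] using h
  · rw [if_neg hF, simpleLowestForm, if_neg hF]
    refine HasLowestForm.const _ ?_
    have h1 := isHomogeneous_mem_pow (tangentForm_isHomogeneous F w)
    have := add_mem (Ideal.pow_le_pow_right one_le_two h) h1
    simpa using this

theorem simpleLowestForm_smul (hF : F.IsHomogeneous e) {c : ℂ} (hc : c ≠ 0) (w : Fin 3 → ℂ) :
    Associated (simpleLowestForm F (c • w)) (simpleLowestForm F w) := by
  have hu : ∀ x : ℂ, x ≠ 0 → IsUnit (C x : S) := fun x hx => (isUnit_iff_ne_zero.2 hx).map C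
  have key : ∀ (x : ℂ) (T : S), x ≠ 0 → Associated (C x * T) T := fun x T hx =>
    associated_unit_mul_left T _ (hu x hx)
  by_cases h : eval w F = 0
  · rw [simpleLowestForm, simpleLowestForm, eval_smul_of_isHomogeneous hF, h, mul_zero,
      if_pos rfl, if_pos rfl, tangentForm_smul hF]
    exact key _ _ (pow_ne_zero _ hc)
  · rw [simpleLowestForm, simpleLowestForm, eval_smul_of_isHomogeneous hF, if_neg h,
      if_neg (mul_ne_zero (pow_ne_zero _ hc) h), C_mul]
    exact key _ _ (pow_ne_zero _ hc)

end Tangent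

/-! ### Comparing expansions in homogeneous and affine coordinates -/

section Chart

variable (α β : ℂ) (a : Fin 2 → ℂ)

/-- The restriction of forms to the plane `α x + β y + z = 0`. -/
noncomputable def restrictToPlane : S →ₐ[ℂ] MvPolynomial (Fin 2) ℂ :=
  aeval ![X 0, X 1, -(C α * X 0) - C β * X 1]

/-- The pull-back under the projection from `chartPoint α β a` to `α x + β y + z = 0`. -/
noncomputable def pullback : MvPolynomial (Fin 2) ℂ →ₐ[ℂ] S :=
  aeval ![X 0 - C (a 0) * lineAtInfinity α β, X 1 - C (a 1) * lineAtInfinity α β]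

theorem translate_dehomogenize (F : S) : translate a (dehomogenize α β F) =
    restrictToPlane α β (expandAt F (chartPoint α β a)) := by
  have : (translate a : MvPolynomial (Fin 2) ℂ →ₐ[ℂ] _).comp (dehomogenize α β) =
      (restrictToPlane α β).comp
        (aeval (fun i => X i + C (chartPoint α β a i)) : S →ₐ[ℂ] S) := by
    ext1 i
    fin_cases i <;>
      simp [dehomogenize, restrictToPlane, translate_apply, chartPoint, algebraMap_eq]
    ring
  exact DFunLike.congr_fun this F

theorem restrictToPlane_pullback (p : MvPolynomial (Fin 2) ℂ) :
    restrictToPlane α β (pullback α β a p) = p := by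
  have : (restrictToPlane α β).comp (pullback α β a) = AlgHom.id ℂ _ := by
    ext1 i
    fin_cases i <;> simp [restrictToPlane, pullback, lineAtInfinity, algebraMap_eq]
  exact DFunLike.congr_fun this p

theorem pullback_restrictToPlane_X (i : Fin 3) : pullback α β a (restrictToPlane α β (X i)) =
    X i - C (chartPoint α β a i) * lineAtInfinity α β := by
  fin_cases i <;> simp [restrictToPlane, pullback, chartPoint, lineAtInfinity, algebraMap_eq]
  ring

/-- If `F` vanishes at the point, then by Euler so does its tangent form there; the form is
therefore invariant under translation along the point and is determined by its restriction to the
plane. -/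
theorem pullback_restrictToPlane_simpleLowestForm {F : S} {e : ℕ} (hF : F.IsHomogeneous e) :
    pullback α β a (restrictToPlane α β (simpleLowestForm F (chartPoint α β a))) =
      simpleLowestForm F (chartPoint α β a) := by
  rw [simpleLowestForm]
  split_ifs with h
  · have h0 := eval_self_tangentForm hF (chartPoint α β a)
    rw [h, mul_zero, eval_tangentForm] at h0
    have hC : ∀ c : ℂ, pullback α β a (restrictToPlane α β (C c)) = C c := fun c => by
      rw [← algebraMap_eq, AlgHom.commutes, AlgHom.commutes]
    simp only [tangentForm, map_sum, map_mul, hC, pullback_restrictToPlane_X, mul_sub,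
      Finset.sum_sub_distrib]
    rw [sub_eq_self]
    have h1 := congrArg (fun c => C c * lineAtInfinity α β) h0
    simp only [C_0, zero_mul, map_sum, Finset.sum_mul, C_mul] at h1
    rw [← h1]
    exact Finset.sum_congr rfl fun i _ => by ring
  · rw [← algebraMap_eq, AlgHom.commutes, AlgHom.commutes]

/-- A square factor of the restriction pulls back to a square factor of `T`. -/
theorem squarefree_restrictToPlane {T : S}
    (hT : pullback α β a (restrictToPlane α β T) = T) (hs : Squarefree T) :
    Squarefree (restrictToPlane α β T) := by
  rintro p ⟨q, hq⟩
  have h1 : IsUnit (pullback α β a p) :=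
    hs _ ⟨pullback α β a q, by rw [← map_mul, ← map_mul, ← hq, hT]⟩
  have := h1.map (restrictToPlane α β)
  rwa [restrictToPlane_pullback] at this

theorem restrictToPlane_hasLowestForm {F G : S} {m : ℕ} (h : HasLowestForm F m G) :
    HasLowestForm (restrictToPlane α β F) m (restrictToPlane α β G) := by
  refine h.aeval _ fun i => ?_
  fin_cases i
  · exact isHomogeneous_X _ _
  · exact isHomogeneous_X _ _
  · exact (isHomogeneous_C_mul_X _ _).neg.sub (isHomogeneous_C_mul_X _ _)

end Chart

/-! ### Multiplicity, tangent cone and Jacobian degree of an arrangement -/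

namespace Arrangement

variable {d k : ℕ} (A : Arrangement d k)

/-- All curves of the arrangement. -/
def curve : Fin d ⊕ Fin k → S := Sum.elim A.line A.conic

theorem exists_curve_isHomogeneous (c : Fin d ⊕ Fin k) : ∃ e, (A.curve c).IsHomogeneous e := by
  rcases c with i | j
  · exact ⟨1, (A.isLine i).1⟩
  · exact ⟨2, (A.isSmoothConic j).1⟩

theorem equation_eq : A.equation = ∏ c, A.curve c := by
  rw [Fintype.prod_sum_type]; rfl

theorem equation_isHomogeneous : A.equation.IsHomogeneous (d + 2 * k) := by
  have h1 := IsHomogeneous.prod Finset.univ A.line (fun _ => 1) fun i _ => (A.isLine i).1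
  have h2 := IsHomogeneous.prod Finset.univ A.conic (fun _ => 2) fun j _ => (A.isSmoothConic j).1
  have := h1.mul h2
  rw [Finset.sum_const, Finset.sum_const, Finset.card_univ, Finset.card_univ, Fintype.card_fin,
    Fintype.card_fin, smul_eq_mul, smul_eq_mul, mul_one, mul_comm k] at this
  exact this

open Classical in
theorem numCurvesThrough_eq (p : P2) :
    A.numCurvesThrough p = ∑ c, if eval p.rep (A.curve c) = 0 then 1 else 0 := by
  rw [Fintype.sum_sum_type, numCurvesThrough, Finset.card_filter, Finset.card_filter]; rfl

open Classical in
theorem numCurvesThrough_mk {w : Fin 3 → ℂ} (hw : w ≠ 0) :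
    A.numCurvesThrough (Projectivization.mk ℂ w hw) =
      ∑ c, if eval w (A.curve c) = 0 then 1 else 0 := by
  rw [numCurvesThrough_eq]
  refine Finset.sum_congr rfl fun c _ => ?_
  obtain ⟨e, he⟩ := A.exists_curve_isHomogeneous c
  simp only [← vanishes_mk he hw, Vanishes]

/-- The lowest form of the equation at `w`. -/
noncomputable def lowestForm (w : Fin 3 → ℂ) : S := ∏ c, simpleLowestForm (A.curve c) w

theorem hasLowestForm {w : Fin 3 → ℂ} (hw : w ≠ 0) :
    HasLowestForm (expandAt A.equation w) (A.numCurvesThrough (Projectivization.mk ℂ w hw))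
      (A.lowestForm w) := by
  classical
  rw [numCurvesThrough_mk, equation_eq, expandAt, map_prod]
  exact HasLowestForm.prod Finset.univ fun c _ => hasLowestForm_expandAt (A.curve c) w

theorem tangentForm_curve_ne_zero (c : Fin d ⊕ Fin k) {w : Fin 3 → ℂ} (hw : w ≠ 0)
    (h : eval w (A.curve c) = 0) : tangentForm (A.curve c) w ≠ 0 := by
  rcases c with i | j
  · rw [show A.curve (Sum.inl i) = A.line i from rfl, tangentForm_eq_self (A.isLine i).1]
    exact (A.isLine i).2
  · intro h0
    rw [tangentForm_eq_zero_iff] at h0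
    have hh := (A.isSmoothConic j).1
    exact (A.isSmoothConic j).2 (Projectivization.mk ℂ w hw)
      ⟨(vanishes_mk hh hw).2 h, fun i => (vanishes_mk hh.pderiv hw).2 (h0 i)⟩

theorem lowestForm_ne_zero {w : Fin 3 → ℂ} (hw : w ≠ 0) : A.lowestForm w ≠ 0 := by
  refine Finset.prod_ne_zero_iff.2 fun c _ => ?_
  rw [simpleLowestForm]
  split_ifs with h
  · exact A.tangentForm_curve_ne_zero c hw h
  · rwa [Ne, C_eq_zero]

theorem lowestForm_smul {c : ℂ} (hc : c ≠ 0) (w : Fin 3 → ℂ) :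
    Associated (A.lowestForm (c • w)) (A.lowestForm w) := by
  refine Associated.prod _ _ _ fun i _ => ?_
  obtain ⟨e, he⟩ := A.exists_curve_isHomogeneous i
  exact simpleLowestForm_smul he hc w

/-- At a singular point the expansion has no part of degree below 2, whereas the nonzero
`lowestForm` has degree equal to the number of curves. -/
theorem two_le_numCurvesThrough {w : Fin 3 → ℂ} (hw : w ≠ 0) (hdk : d + 2 * k ≠ 0)
    (h : ∀ i, eval w (pderiv i A.equation) = 0) :
    2 ≤ A.numCurvesThrough (Projectivization.mk ℂ w hw) := by
  have h1 := (tangentForm_eq_zero_iff _ _).2 h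
  have h2 := eval_self_tangentForm A.equation_isHomogeneous w
  rw [h1, map_zero, eq_comm, mul_eq_zero, or_iff_right (Nat.cast_ne_zero.2 hdk)] at h2
  have h3 := expandAt_sub_mem A.equation w
  rw [h1, h2, C_0, sub_zero, sub_zero] at h3
  by_contra hlt
  have h4 := A.hasLowestForm hw
  exact A.lowestForm_ne_zero hw
    (h4.homogeneousComponent_eq.symm.trans (homogeneousComponent_eq_zero_of_mem_pow h3 (by omega)))

theorem isSingularPoint_of_two_le {p : P2} (h : 2 ≤ A.numCurvesThrough p) :
    IsSingularPoint A.equation p := by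
  have h1 := A.hasLowestForm p.rep_nonzero
  rw [Projectivization.mk_rep] at h1
  have h2 := Ideal.pow_le_pow_right h h1.mem_pow
  have h3 := sub_mem h2 (expandAt_sub_mem A.equation p.rep)
  rw [sub_sub, sub_sub_cancel] at h3
  have h4 := homogeneousComponent_eq_zero_of_mem_pow h3 (by norm_num : 0 < 2)
  have h5 := homogeneousComponent_eq_zero_of_mem_pow h3 (by norm_num : 1 < 2)
  rw [map_add, homogeneousComponent_of_mem (isHomogeneous_C _ _), if_pos rfl,
    homogeneousComponent_of_mem (tangentForm_isHomogeneous _ _), if_neg (by norm_num), add_zero,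
    C_eq_zero] at h4
  rw [map_add, homogeneousComponent_of_mem (isHomogeneous_C _ _), if_neg (by norm_num),
    homogeneousComponent_of_mem (tangentForm_isHomogeneous _ _), if_pos rfl, zero_add,
    tangentForm_eq_zero_iff] at h5
  exact ⟨h4, h5⟩

variable {A}

/-- At an ordinary singularity, the multiplicity is the number of curves, and the tangents of the
curves are distinct. -/
theorem HasOrdinarySingularities.squarefree_lowestForm {N : ℕ} (hA : A.HasOrdinarySingularities N)
    {w : Fin 3 → ℂ} (hw : w ≠ 0) (h : 2 ≤ A.numCurvesThrough (Projectivization.mk ℂ w hw)) :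
    A.numCurvesThrough (Projectivization.mk ℂ w hw) ≤ N ∧ Squarefree (A.lowestForm w) := by
  set p := Projectivization.mk ℂ w hw with hp
  obtain ⟨m, hm, h0, h1, h2⟩ := hA p (A.isSingularPoint_of_two_le h)
  have h3 := A.hasLowestForm p.rep_nonzero
  rw [Projectivization.mk_rep] at h3
  obtain ⟨h4, h5⟩ := h3.unique (A.lowestForm_ne_zero p.rep_nonzero) h0 h1
  rw [h5] at h2
  refine ⟨h4 ▸ hm, ?_⟩
  obtain ⟨c, hc⟩ := Projectivization.exists_smul_eq_mk_rep ℂ w hw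
  rw [← hp] at hc
  rw [← hc, Units.smul_def] at h2
  exact (A.lowestForm_smul c.ne_zero w).squarefree_iff.1 h2

/-- The degree of the Jacobian ideal is the sum of the Tjurina numbers, at the points where at
least two curves meet. -/
theorem HasOrdinarySingularities.degree_jacobianIdeal (hA : A.HasOrdinarySingularities 4)
    (hdk : d + 2 * k ≠ 0) {n : ℕ} (hn : HasDegree (jacobianIdeal A.equation) n) (Z : Finset P2)
    (hZ : ∀ p, p ∈ Z ↔ 2 ≤ A.numCurvesThrough p) :
    n = ∑ p ∈ Z, (A.numCurvesThrough p - 1) ^ 2 := by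
  classical
  -- Choice of a line at infinity off the finite set `Z`: the bad pairs `(α, β)` are the zeros of a
  -- nonzero polynomial, a product of one affine-linear factor for each point.
  obtain ⟨a₀, ha₀⟩ : ∃ a₀ : Fin 2 → ℂ, ∀ p ∈ Z,
      a₀ 0 * p.rep 0 + a₀ 1 * p.rep 1 + p.rep 2 ≠ 0 := by
    let P : MvPolynomial (Fin 2) ℂ :=
      ∏ p ∈ Z, (X 0 * C (p.rep 0) + X 1 * C (p.rep 1) + C (p.rep 2))
    have hP : P ≠ 0 := by
      refine Finset.prod_ne_zero_iff.2 fun p _ h0 => p.rep_nonzero ?_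
      have e0 := congrArg (eval ![0, 0]) h0
      have e1 := congrArg (eval ![1, 0]) h0
      have e2 := congrArg (eval ![0, 1]) h0
      simp only [map_add, map_mul, eval_X, eval_C, map_zero, Matrix.cons_val_zero,
        Matrix.cons_val_one, zero_mul, one_mul, zero_add, add_zero] at e0 e1 e2
      rw [e0, add_zero] at e1 e2
      ext i; fin_cases i
      · exact e1
      · exact e2
      · exact e0
    by_contra hc
    push Not at hc
    refine hP (MvPolynomial.funext fun a => ?_)
    obtain ⟨p, hp, h⟩ := hc a
    rw [map_prod, map_zero]
    refine Finset.prod_eq_zero hp ?_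
    simpa using h
  set α := a₀ 0
  set β := a₀ 1
  have hchart : ∀ a, chartPoint α β a ≠ 0 := fun a h0 => by
    have h : α * chartPoint α β a 0 + β * chartPoint α β a 1 + chartPoint α β a 2 = 1 := by
      simp [chartPoint]
    rw [h0] at h
    simp at h
  let κ : P2 → Fin 2 → ℂ := fun p =>
    (α * p.rep 0 + β * p.rep 1 + p.rep 2)⁻¹ • ![p.rep 0, p.rep 1]
  have hκ : ∀ p ∈ Z, Projectivization.mk ℂ (chartPoint α β (κ p)) (hchart _) = p := by
    intro p hp
    conv_rhs => rw [← p.mk_rep]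
    rw [Projectivization.mk_eq_mk_iff']
    refine ⟨(α * p.rep 0 + β * p.rep 1 + p.rep 2)⁻¹, ?_⟩
    have h := congrArg ((α * p.rep 0 + β * p.rep 1 + p.rep 2)⁻¹ • ·) (smul_chartPoint α β (ha₀ p hp))
    simp only [smul_smul, inv_mul_cancel₀ (ha₀ p hp), one_smul] at h
    exact h.symm
  have hκinj : Set.InjOn κ Z := fun p hp q hq h => by
    rw [← hκ p hp, ← hκ q hq]; simp only [h]
  have hw : ∀ w : Fin 3 → ℂ, w ≠ 0 → (∀ i, eval w (pderiv i A.equation) = 0) →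
      ∃ p ∈ Z, ∃ c : ℂ, c ≠ 0 ∧ p.rep = c • w := by
    intro w hw0 hw
    obtain ⟨c, hc⟩ := Projectivization.exists_smul_eq_mk_rep ℂ w hw0
    exact ⟨_, (hZ _).2 (A.two_le_numCurvesThrough hw0 hdk hw), c, c.ne_zero, hc.symm⟩
  have key := degree_jacobianIdeal_eq_sum (α := α) (β := β) A.equation_isHomogeneous hdk hn
    (fun w h h0 => ?_) (Z.image κ) (fun a ha => ?_)
    (fun a => A.numCurvesThrough (Projectivization.mk ℂ (chartPoint α β a) (hchart a)))
    (fun a ha => ?_)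
  · rw [key, Finset.sum_image hκinj]
    exact Finset.sum_congr rfl fun p hp => by simp only [hκ p hp]
  · by_contra hw0
    obtain ⟨p, hp, c, -, hc⟩ := hw w hw0 h
    refine ha₀ p hp ?_
    simp only [hc, Pi.smul_apply, smul_eq_mul]
    linear_combination c * h0
  · obtain ⟨p, hp, c, hc0, hc⟩ := hw _ (hchart a) ha
    refine Finset.mem_image.2 ⟨p, hp, ?_⟩
    have hl : α * p.rep 0 + β * p.rep 1 + p.rep 2 = c := by
      rw [hc]; simp [chartPoint]; ring
    have h0 : p.rep 0 = c * a 0 := by rw [hc]; simp [chartPoint]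
    have h1 : p.rep 1 = c * a 1 := by rw [hc]; simp [chartPoint]
    simp only [κ, hl]
    rw [h0, h1]
    ext i; fin_cases i <;> simp [hc0]
  · obtain ⟨p, hp, rfl⟩ := Finset.mem_image.1 ha
    have h2 : 2 ≤ A.numCurvesThrough
        (Projectivization.mk ℂ (chartPoint α β (κ p)) (hchart (κ p))) := by
      rw [hκ p hp]; exact (hZ p).1 hp
    obtain ⟨h4, hs⟩ := hA.squarefree_lowestForm (hchart (κ p)) h2
    refine ⟨h2, h4, restrictToPlane α β (A.lowestForm (chartPoint α β (κ p))), ?_, ?_⟩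
    · rw [translate_dehomogenize]
      exact restrictToPlane_hasLowestForm α β (A.hasLowestForm (hchart _))
    · refine squarefree_restrictToPlane α β (κ p) ?_ hs
      rw [lowestForm, map_prod, map_prod]
      refine Finset.prod_congr rfl fun c _ => ?_
      obtain ⟨e, he⟩ := A.exists_curve_isHomogeneous c
      exact pullback_restrictToPlane_simpleLowestForm α β (κ p) he

end Arrangement

/-! ### Lines in the plane -/

section LinearForms

variable {L L' : S}

theorem eval_comb_of_isHomogeneous_one (hL : L.IsHomogeneous 1) (s t : ℂ) (v w : Fin 3 → ℂ) :
    eval (s • v + t • w) L = s * eval v L + t * eval w L := by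
  rw [← tangentForm_eq_self hL 0]
  simp only [eval_tangentForm, Finset.mul_sum, ← Finset.sum_add_distrib]
  refine Finset.sum_congr rfl fun i _ => ?_
  simp only [Pi.add_apply, Pi.smul_apply, smul_eq_mul]
  ring

/-- The linear functional given by a form of degree one. -/
noncomputable def toLinearMap (hL : L.IsHomogeneous 1) : (Fin 3 → ℂ) →ₗ[ℂ] ℂ where
  toFun w := eval w L
  map_add' v w := by simpa using eval_comb_of_isHomogeneous_one hL 1 1 v w
  map_smul' c w := by simpa using eval_comb_of_isHomogeneous_one hL c 0 w 0

theorem finrank_ker_toLinearMap (hL : L.IsHomogeneous 1) (h0 : L ≠ 0) :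
    Module.finrank ℂ (LinearMap.ker (toLinearMap hL)) = 2 := by
  have hne : toLinearMap hL ≠ 0 := fun h => h0 (MvPolynomial.funext fun w => by
    rw [map_zero]; exact DFunLike.congr_fun h w)
  have h := LinearMap.finrank_range_add_finrank_ker (toLinearMap hL)
  rw [LinearMap.range_eq_top.2 (LinearMap.surjective hne), finrank_top, Module.finrank_self,
    Module.finrank_fin_fun] at h
  omega

theorem exists_ne_zero_eval_eq_zero (hL : L.IsHomogeneous 1) (h0 : L ≠ 0) :
    ∃ w : Fin 3 → ℂ, w ≠ 0 ∧ eval w L = 0 := by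
  have h := finrank_ker_toLinearMap hL h0
  have : LinearMap.ker (toLinearMap hL) ≠ ⊥ := by
    intro hb; rw [hb, finrank_bot] at h; omega
  obtain ⟨w, hw, hw0⟩ := Submodule.exists_mem_ne_zero_of_ne_bot this
  exact ⟨w, hw0, hw⟩

/-- A point of a line can be completed to a basis of the line. -/
theorem exists_basis_of_line (hL : L.IsHomogeneous 1) (h0 : L ≠ 0) {w : Fin 3 → ℂ} (hw : w ≠ 0)
    (hwL : eval w L = 0) : ∃ u : Fin 3 → ℂ, eval u L = 0 ∧
      (∀ s t : ℂ, s • w + t • u = 0 → s = 0 ∧ t = 0) ∧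
      ∀ v, eval v L = 0 → ∃ s t : ℂ, v = s • w + t • u := by
  have hfr := finrank_ker_toLinearMap hL h0
  set K := LinearMap.ker (toLinearMap hL) with hK
  let w' : K := ⟨w, hwL⟩
  have hw' : w' ≠ 0 := fun h => hw (congrArg Subtype.val h)
  obtain ⟨u, hu⟩ : ∃ u : K, u ∉ Submodule.span ℂ {w'} := by
    by_contra hc
    push Not at hc
    have : Module.finrank ℂ K ≤ 1 := finrank_le_one w' fun v =>
      Submodule.mem_span_singleton.1 (hc v)
    omega
  have hli : LinearIndependent ℂ ![w', u] := by
    rw [LinearIndependent.pair_iff' hw']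
    intro a ha
    exact hu (Submodule.mem_span_singleton.2 ⟨a, ha⟩)
  have hspan := hli.span_eq_top_of_card_eq_finrank (by simp [hfr])
  refine ⟨u, u.2, fun s t h => ?_, fun v hv => ?_⟩
  · exact LinearIndependent.pair_iff.1 hli s t (Subtype.ext h)
  · have hv' : (⟨v, hv⟩ : K) ∈ Submodule.span ℂ (Set.range ![w', u]) := hspan ▸ Submodule.mem_top
    rw [Matrix.range_cons, Matrix.range_cons, Matrix.range_empty, Set.union_empty,
      Set.singleton_union, Submodule.mem_span_pair] at hv'
    obtain ⟨s, t, h⟩ := hv'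
    exact ⟨s, t, (congrArg Subtype.val h).symm⟩

/-- A linear form that vanishes on a line is its equation. -/
theorem associated_of_forall_eval_eq_zero (hL : L.IsHomogeneous 1) (hL' : L'.IsHomogeneous 1)
    (h0' : L' ≠ 0) (h : ∀ w, eval w L = 0 → eval w L' = 0) : Associated L L' := by
  obtain ⟨c, hc⟩ : ∃ c : ℂ, L' = C c * L := by
    by_cases hz : ∃ v, eval v L ≠ 0
    · obtain ⟨v, hv⟩ := hz
      refine ⟨eval v L' / eval v L, MvPolynomial.funext fun w => ?_⟩
      have h1 := h ((1 : ℂ) • w + (-(eval w L / eval v L)) • v) (by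
        rw [eval_comb_of_isHomogeneous_one hL]; field_simp; ring)
      rw [eval_comb_of_isHomogeneous_one hL'] at h1
      rw [map_mul, eval_C]
      field_simp at h1 ⊢
      linear_combination h1
    · push Not at hz
      exact absurd (MvPolynomial.funext fun w => by rw [h w (hz w), map_zero]) h0'
  have hc0 : c ≠ 0 := by rintro rfl; simp at hc; exact h0' hc
  rw [hc]
  exact (associated_unit_mul_left L _ ((isUnit_iff_ne_zero.2 hc0).map C)).symm

theorem exists_eval_ne_zero_of_not_associated (hL : L.IsHomogeneous 1) (hL' : L'.IsHomogeneous 1)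
    (h0' : L' ≠ 0) (hne : ¬ Associated L L') : ∃ w, eval w L = 0 ∧ eval w L' ≠ 0 := by
  by_contra hc
  push Not at hc
  exact hne (associated_of_forall_eval_eq_zero hL hL' h0' hc)

theorem mk_eq_of_rep_eq {p : P2} {w : Fin 3 → ℂ} (hw : w ≠ 0) {c : ℂ} (h : p.rep = c • w) :
    p = Projectivization.mk ℂ w hw := by
  rw [← p.mk_rep, Projectivization.mk_eq_mk_iff']
  exact ⟨c, h.symm⟩

/-- Two distinct lines meet in exactly one point. -/
theorem exists_inter_lines_eq_singleton (hL : IsLine L) (hL' : IsLine L')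
    (hne : ¬ Associated L L') : ∃ p, {q : P2 | Vanishes L q ∧ Vanishes L' q} = {p} := by
  obtain ⟨v, hv, hv'⟩ := exists_eval_ne_zero_of_not_associated hL.1 hL'.1 hL'.2 hne
  have hv0 : v ≠ 0 := by
    rintro rfl
    exact hv' (by simpa using eval_smul_of_isHomogeneous hL'.1 0 0)
  obtain ⟨u, hu, hli, hsp⟩ := exists_basis_of_line hL.1 hL.2 hv0 hv
  -- The combination of the basis vectors `v`, `u` of the first line on which `L'` vanishes.
  set w := eval u L' • v + (-(eval v L')) • u with hw
  have hw0 : w ≠ 0 := fun h => hv' (neg_eq_zero.1 (hli _ _ h).2)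
  have hwL : eval w L = 0 := by rw [eval_comb_of_isHomogeneous_one hL.1, hv, hu]; ring
  have hwL' : eval w L' = 0 := by rw [eval_comb_of_isHomogeneous_one hL'.1]; ring
  refine ⟨Projectivization.mk ℂ w hw0, Set.ext fun q => ?_⟩
  rw [Set.mem_singleton_iff]
  constructor
  · rintro ⟨h1, h2⟩
    obtain ⟨s, t, hst⟩ := hsp _ h1
    rw [Vanishes, hst, eval_comb_of_isHomogeneous_one hL'.1] at h2
    refine mk_eq_of_rep_eq hw0 (c := -t / eval v L') ?_
    rw [hst, hw, smul_add, smul_smul, smul_smul]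
    congr 2
    · field_simp; linear_combination h2
    · field_simp
  · rintro rfl
    exact ⟨(vanishes_mk hL.1 hw0).2 hwL, (vanishes_mk hL'.1 hw0).2 hwL'⟩

end LinearForms

/-! ### Intersection of a line and a conic -/

section Conic

variable {Q L : S}

/-- Both sides are additive in `Q`, and quadratic forms are sums of products of linear forms. -/
theorem eval_comb_of_isHomogeneous_two (hQ : Q.IsHomogeneous 2) (s t : ℂ) (v w : Fin 3 → ℂ) :
    eval (s • v + t • w) Q =
      s ^ 2 * eval v Q + s * t * eval w (tangentForm Q v) + t ^ 2 * eval w Q := by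
  have hmem : Q ∈ homogeneousSubmodule (Fin 3) ℂ 1 * homogeneousSubmodule (Fin 3) ℂ 1 := by
    rw [← pow_two, homogeneousSubmodule_one_pow]; exact hQ
  induction hmem using Submodule.mul_induction_on' with
  | mem_mul_mem F hF G hG =>
    have h1 : eval w (tangentForm (F * G) v) = eval w F * eval v G + eval v F * eval w G := by
      have e1 := congrArg (eval w) (tangentForm_eq_self hF v)
      have e2 := congrArg (eval w) (tangentForm_eq_self hG v)
      rw [eval_tangentForm] at e1 e2 ⊢
      rw [← e1, ← e2, Finset.sum_mul, Finset.mul_sum, ← Finset.sum_add_distrib]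
      refine Finset.sum_congr rfl fun i _ => ?_
      rw [pderiv_mul, map_add, map_mul, map_mul]
      ring
    rw [h1, map_mul, map_mul, map_mul, eval_comb_of_isHomogeneous_one hF,
      eval_comb_of_isHomogeneous_one hG]
    ring
  | add F hF G hG h1 h2 =>
    have hF' : F.IsHomogeneous 2 := homogeneousSubmodule_mul 1 1 hF
    have hG' : G.IsHomogeneous 2 := homogeneousSubmodule_mul 1 1 hG
    have h3 : eval w (tangentForm (F + G) v) =
        eval w (tangentForm F v) + eval w (tangentForm G v) := by
      simp only [eval_tangentForm, map_add, mul_add, Finset.sum_add_distrib]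
    rw [h3, map_add, map_add, map_add, h1 hF', h2 hG']
    ring

/-- Every line meets every conic. -/
theorem exists_mem_line_conic (hL : IsLine L) (hQ : Q.IsHomogeneous 2) :
    ∃ w : Fin 3 → ℂ, w ≠ 0 ∧ eval w L = 0 ∧ eval w Q = 0 := by
  obtain ⟨v, hv0, hv⟩ := exists_ne_zero_eval_eq_zero hL.1 hL.2
  by_cases hvQ : eval v Q = 0
  · exact ⟨v, hv0, hv, hvQ⟩
  obtain ⟨u, hu, hli, -⟩ := exists_basis_of_line hL.1 hL.2 hv0 hv
  obtain ⟨δ, hδ⟩ := IsAlgClosed.exists_pow_nat_eq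
    (discrim (eval v Q) (eval u (tangentForm Q v)) (eval u Q)) (zero_lt_two)
  obtain ⟨s, hs⟩ := exists_quadratic_eq_zero hvQ ⟨δ, by rw [← hδ, pow_two]⟩
  refine ⟨s • v + (1 : ℂ) • u, fun h => one_ne_zero (hli _ _ h).2, ?_, ?_⟩
  · rw [eval_comb_of_isHomogeneous_one hL.1, hv, hu]; ring
  · rw [eval_comb_of_isHomogeneous_two hQ]; linear_combination hs

/-- A line which is nowhere tangent to a conic meets it in exactly two points. -/
theorem exists_inter_line_conic_eq_pair (hL : IsLine L) (hQ : IsSmoothConic Q)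
    (hne : ∀ w : Fin 3 → ℂ, w ≠ 0 → eval w L = 0 → eval w Q = 0 →
      ¬ Associated L (tangentForm Q w)) :
    ∃ p p', p ≠ p' ∧ {q : P2 | Vanishes L q ∧ Vanishes Q q} = {p, p'} := by
  obtain ⟨w, hw0, hwL, hwQ⟩ := exists_mem_line_conic hL hQ.1
  obtain ⟨u, hu, hli, hsp⟩ := exists_basis_of_line hL.1 hL.2 hw0 hwL
  have hT0 : tangentForm Q w ≠ 0 := fun h0 => by
    rw [tangentForm_eq_zero_iff] at h0
    exact hQ.2 (Projectivization.mk ℂ w hw0)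
      ⟨(vanishes_mk hQ.1 hw0).2 hwQ, fun i => (vanishes_mk hQ.1.pderiv hw0).2 (h0 i)⟩
  have hTw : eval w (tangentForm Q w) = 0 := by
    rw [eval_self_tangentForm hQ.1, hwQ, mul_zero]
  set b := eval u (tangentForm Q w) with hb
  -- If `b = 0`, the tangent form at `w` vanishes on the whole line, which is then the tangent.
  have hb0 : b ≠ 0 := by
    intro hb0
    obtain ⟨x, hx, hx'⟩ := exists_eval_ne_zero_of_not_associated hL.1 (tangentForm_isHomogeneous Q w)
      hT0 (hne w hw0 hwL hwQ)
    obtain ⟨s, t, rfl⟩ := hsp x hx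
    rw [eval_comb_of_isHomogeneous_one (tangentForm_isHomogeneous Q w), hTw, ← hb, hb0] at hx'
    simp at hx'
  have hQst : ∀ s t : ℂ, eval (s • w + t • u) Q = t * (s * b + t * eval u Q) := fun s t => by
    rw [eval_comb_of_isHomogeneous_two hQ.1, hwQ]; ring
  have hLst : ∀ s t : ℂ, eval (s • w + t • u) L = 0 := fun s t => by
    rw [eval_comb_of_isHomogeneous_one hL.1, hwL, hu]; ring
  -- On the line, `Q = t (s b + t Q(u))`. The root `t = 0` is `w`; the other factor vanishes at `(s,
  -- t) = (Q(u), -b)`, a different point because `b ≠ 0`.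
  set w' := eval u Q • w + (-b) • u with hw'
  have hw'0 : w' ≠ 0 := fun h => hb0 (neg_eq_zero.1 (hli _ _ h).2)
  refine ⟨Projectivization.mk ℂ w hw0, Projectivization.mk ℂ w' hw'0, ?_, Set.ext fun q => ?_⟩
  · intro h
    rw [Projectivization.mk_eq_mk_iff'] at h
    obtain ⟨c, hc⟩ := h
    have h1 : (c * eval u Q - 1) • w + (-(c * b)) • u = 0 := by
      rw [← sub_eq_zero.2 hc, hw']; module
    obtain ⟨h2, h3⟩ := hli _ _ h1
    have hc0 : c = 0 := (mul_eq_zero.1 (neg_eq_zero.1 h3)).resolve_right hb0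
    rw [hc0] at h2
    simp at h2
  · rw [Set.mem_insert_iff, Set.mem_singleton_iff]
    constructor
    · rintro ⟨h1, h2⟩
      obtain ⟨s, t, hst⟩ := hsp _ h1
      rw [Vanishes, hst, hQst, mul_eq_zero] at h2
      rcases h2 with rfl | h2
      · left
        exact mk_eq_of_rep_eq hw0 (c := s) (by rw [hst, zero_smul, add_zero])
      · right
        refine mk_eq_of_rep_eq hw'0 (c := -t / b) ?_
        rw [hst, hw', smul_add, smul_smul, smul_smul]
        congr 2
        · field_simp; linear_combination h2
        · field_simp
    · rintro (rfl | rfl)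
      · exact ⟨(vanishes_mk hL.1 hw0).2 hwL, (vanishes_mk hQ.1 hw0).2 hwQ⟩
      · exact ⟨(vanishes_mk hL.1 hw'0).2 (hLst _ _),
          (vanishes_mk hQ.1 hw'0).2 (by rw [hQst]; ring)⟩

end Conic

/-! ### Transversality of the lines and the conics -/

namespace Arrangement

variable {d k N : ℕ} {A : Arrangement d k}

-- For a tangent line, the square of its equation would divide the lowest form of the arrangement,
-- which is squarefree.
open Classical in
theorem HasOrdinarySingularities.not_associated_tangentForm (hA : A.HasOrdinarySingularities N)
    (i : Fin d) (j : Fin k) {w : Fin 3 → ℂ} (hw : w ≠ 0) (hi : eval w (A.line i) = 0)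
    (hj : eval w (A.conic j) = 0) : ¬ Associated (A.line i) (tangentForm (A.conic j) w) := by
  intro h
  have hne : (Sum.inl i : Fin d ⊕ Fin k) ≠ Sum.inr j := Sum.inl_ne_inr
  have h2 : 2 ≤ A.numCurvesThrough (Projectivization.mk ℂ w hw) := by
    rw [numCurvesThrough_mk, ← Finset.card_filter, ← Finset.card_pair hne]
    refine Finset.card_le_card fun c hc => ?_
    rw [Finset.mem_insert, Finset.mem_singleton] at hc
    rw [Finset.mem_filter]
    rcases hc with rfl | rfl
    · exact ⟨Finset.mem_univ _, hi⟩
    · exact ⟨Finset.mem_univ _, hj⟩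
  obtain ⟨-, hs⟩ := hA.squarefree_lowestForm hw h2
  have hdvd : simpleLowestForm (A.line i) w * simpleLowestForm (A.conic j) w ∣ A.lowestForm w := by
    have := Finset.prod_dvd_prod_of_subset {Sum.inl i, Sum.inr j} Finset.univ
      (fun c => simpleLowestForm (A.curve c) w) (Finset.subset_univ _)
    rwa [Finset.prod_pair hne] at this
  rw [simpleLowestForm, simpleLowestForm, if_pos hi, if_pos hj,
    tangentForm_eq_self (A.isLine i).1] at hdvd
  have hu := hs _ ((mul_dvd_mul_left _ h.dvd).trans hdvd)
  have h3 := hu.map (eval w)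
  rw [hi] at h3
  exact not_isUnit_zero h3

theorem HasOrdinarySingularities.exists_inter_line_conic_eq_pair
    (hA : A.HasOrdinarySingularities N) (i : Fin d) (j : Fin k) :
    ∃ p p', p ≠ p' ∧ {q : P2 | Vanishes (A.line i) q ∧ Vanishes (A.conic j) q} = {p, p'} :=
  ConicLine.exists_inter_line_conic_eq_pair (A.isLine i) (A.isSmoothConic j)
    fun _ hw hi hj => hA.not_associated_tangentForm i j hw hi hj

end Arrangement

/-! ### Incidence counts for lines and one conic -/

namespace Arrangement

variable {d : ℕ}

open Classical in
/-- The number of lines of the arrangement that pass through `p`. -/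
noncomputable def numLinesThrough {k : ℕ} (A : Arrangement d k) (p : P2) : ℕ :=
  (Finset.univ.filter fun i => Vanishes (A.line i) p).card

open Classical in
theorem numCurvesThrough_eq_add (A : Arrangement d 1) (p : P2) :
    A.numCurvesThrough p = A.numLinesThrough p + if Vanishes (A.conic 0) p then 1 else 0 := by
  rw [numCurvesThrough, numLinesThrough, Finset.card_filter (fun j => Vanishes (A.conic j) p),
    Fin.sum_univ_one]

theorem numCurvesThrough_deleteConic (A : Arrangement d 1) (p : P2) :
    (A.deleteConic 0).numCurvesThrough p = A.numLinesThrough p := by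
  classical
  rw [numCurvesThrough, numLinesThrough, Finset.univ_eq_empty (α := Fin 0), Finset.filter_empty,
    Finset.card_empty, add_zero]
  rfl

theorem vanishes_deleteConic_equation (A : Arrangement d 1) (p : P2) :
    Vanishes (A.deleteConic 0).equation p ↔ 1 ≤ A.numLinesThrough p := by
  classical
  rw [Vanishes, equation, Finset.univ_eq_empty (α := Fin 0), Finset.prod_empty, mul_one, map_prod,
    Finset.prod_eq_zero_iff, numLinesThrough, Nat.one_le_iff_ne_zero, Finset.card_ne_zero]
  constructor
  · rintro ⟨i, -, hi⟩; exact ⟨i, Finset.mem_filter.2 ⟨Finset.mem_univ _, hi⟩⟩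
  · rintro ⟨i, hi⟩; exact ⟨i, Finset.mem_univ _, (Finset.mem_filter.1 hi).2⟩

theorem numLinesThrough_le {k : ℕ} (A : Arrangement d k) (p : P2) : A.numLinesThrough p ≤ d := by
  classical
  exact (Finset.card_filter_le _ _).trans (by simp)

variable {A : Arrangement d 1} {N : ℕ}

theorem HasOrdinarySingularities.finite_setOf_two_le (hA : A.HasOrdinarySingularities N) :
    {p : P2 | 2 ≤ A.numCurvesThrough p}.Finite := by
  classical
  have hfin : (⋃ x : Fin d × Fin d, {q : P2 | x.1 ≠ x.2 ∧ Vanishes (A.line x.1) q ∧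
      Vanishes (A.line x.2) q} ∪ {q : P2 | Vanishes (A.line x.1) q ∧ Vanishes (A.conic 0) q}).Finite := by
    refine Set.finite_iUnion fun x => Set.Finite.union ?_ ?_
    · by_cases hx : x.1 = x.2
      · simp [hx]
      · obtain ⟨p, hp⟩ := exists_inter_lines_eq_singleton (A.isLine x.1) (A.isLine x.2)
          (A.line_distinct _ _ hx)
        refine (Set.finite_singleton p).subset ?_
        rw [← hp]
        exact Set.ofPred_subset_ofPred.2 fun q hq => hq.2
    · obtain ⟨p, p', -, hp⟩ := hA.exists_inter_line_conic_eq_pair x.1 0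
      rw [hp]
      exact Set.toFinite _
  refine hfin.subset (Set.ofPred_subset.2 fun p hp => ?_)
  rw [numCurvesThrough_eq_add] at hp
  rw [Set.mem_iUnion]
  by_cases h1 : 1 < A.numLinesThrough p
  · obtain ⟨i, hi, j, hj, hij⟩ := Finset.one_lt_card.1 h1
    exact ⟨(i, j), Or.inl ⟨hij, (Finset.mem_filter.1 hi).2, (Finset.mem_filter.1 hj).2⟩⟩
  · by_cases hc : Vanishes (A.conic 0) p
    · rw [if_pos hc] at hp
      obtain ⟨i, hi⟩ := Finset.card_pos.1 (show 0 < A.numLinesThrough p by omega)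
      exact ⟨(i, i), Or.inr ⟨(Finset.mem_filter.1 hi).2, hc⟩⟩
    · rw [if_neg hc] at hp
      omega

section Count

variable {Z : Finset P2}

/-- Double count of ordered pairs of distinct lines: each pair meets in exactly one point, which
lies in `Z`. -/
theorem sum_numLinesThrough_mul_sub_one (hZ : ∀ p, p ∈ Z ↔ 2 ≤ A.numCurvesThrough p) :
    ∑ p ∈ Z, ((A.numLinesThrough p : ℤ) * (A.numLinesThrough p - 1)) = d * (d - 1) := by
  classical
  have h1 : ∀ p, ((A.numLinesThrough p : ℤ) * (A.numLinesThrough p - 1)) =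
      ∑ x ∈ (Finset.univ : Finset (Fin d)).offDiag,
        if Vanishes (A.line x.1) p ∧ Vanishes (A.line x.2) p then 1 else 0 := by
    intro p
    have h2 : (Finset.univ : Finset (Fin d)).offDiag.filter
        (fun x => Vanishes (A.line x.1) p ∧ Vanishes (A.line x.2) p) =
        (Finset.univ.filter fun i => Vanishes (A.line i) p).offDiag := by
      ext x; simp [Finset.mem_offDiag]; tauto
    rw [← Finset.sum_filter, h2, Finset.sum_const, Finset.offDiag_card, nsmul_eq_mul, mul_one,
      Nat.cast_sub (Nat.le_mul_self _), Nat.cast_mul, numLinesThrough]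
    ring
  have h3 : ∀ x ∈ (Finset.univ : Finset (Fin d)).offDiag,
      ∑ p ∈ Z, (if Vanishes (A.line x.1) p ∧ Vanishes (A.line x.2) p then (1 : ℤ) else 0) = 1 := by
    intro x hx
    have hx' := (Finset.mem_offDiag.1 hx).2.2
    obtain ⟨p, hp⟩ := exists_inter_lines_eq_singleton (A.isLine x.1) (A.isLine x.2)
      (A.line_distinct _ _ hx')
    have hiff : ∀ q, (Vanishes (A.line x.1) q ∧ Vanishes (A.line x.2) q) ↔ q = p := fun q => by
      have := Set.ext_iff.1 hp q
      rwa [Set.mem_ofPred_eq, Set.mem_singleton_iff] at this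
    simp only [hiff]
    rw [Finset.sum_ite_eq' Z p, if_pos]
    rw [hZ, numCurvesThrough_eq_add]
    have h4 : 1 < A.numLinesThrough p := Finset.one_lt_card.2
      ⟨x.1, Finset.mem_filter.2 ⟨Finset.mem_univ _, ((hiff p).2 rfl).1⟩,
        x.2, Finset.mem_filter.2 ⟨Finset.mem_univ _, ((hiff p).2 rfl).2⟩, hx'⟩
    omega
  rw [Finset.sum_congr rfl fun p _ => h1 p, Finset.sum_comm, Finset.sum_congr rfl h3,
    Finset.sum_const, Finset.offDiag_card, Finset.card_univ, Fintype.card_fin, nsmul_eq_mul,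
    mul_one, Nat.cast_sub (Nat.le_mul_self _), Nat.cast_mul]
  ring

-- Double count of incidences on the conic: each line meets it in two distinct points, all of which
-- lie in `Z`.
open Classical in
theorem sum_numLinesThrough_on_conic (hA : A.HasOrdinarySingularities N)
    (hZ : ∀ p, p ∈ Z ↔ 2 ≤ A.numCurvesThrough p) :
    ∑ p ∈ Z, (if Vanishes (A.conic 0) p then (A.numLinesThrough p : ℤ) else 0) = 2 * d := by
  have h1 : ∀ p, (if Vanishes (A.conic 0) p then (A.numLinesThrough p : ℤ) else 0) =
      ∑ i, if Vanishes (A.line i) p ∧ Vanishes (A.conic 0) p then 1 else 0 := by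
    intro p
    split_ifs with h
    · simp only [h, and_true]
      rw [numLinesThrough, Finset.card_filter]
      push_cast
      rfl
    · simp [h]
  have h3 : ∀ i, ∑ p ∈ Z,
      (if Vanishes (A.line i) p ∧ Vanishes (A.conic 0) p then (1 : ℤ) else 0) = 2 := by
    intro i
    obtain ⟨p, p', hne, hp⟩ := hA.exists_inter_line_conic_eq_pair i 0
    have hiff : ∀ q, (Vanishes (A.line i) q ∧ Vanishes (A.conic 0) q) ↔ q = p ∨ q = p' :=
      fun q => by
        have := Set.ext_iff.1 hp q
        rwa [Set.mem_ofPred_eq, Set.mem_insert_iff, Set.mem_singleton_iff] at this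
    have hfil : Z.filter (fun q => Vanishes (A.line i) q ∧ Vanishes (A.conic 0) q) = {p, p'} := by
      ext q
      rw [Finset.mem_filter, hiff, Finset.mem_insert, Finset.mem_singleton, and_iff_right_iff_imp]
      intro hq
      obtain ⟨h4, h5⟩ := (hiff q).2 hq
      rw [hZ, numCurvesThrough_eq_add, if_pos h5]
      have h6 : 0 < A.numLinesThrough q :=
        Finset.card_pos.2 ⟨i, Finset.mem_filter.2 ⟨Finset.mem_univ _, h4⟩⟩
      omega
    rw [← Finset.sum_filter, hfil, Finset.sum_const, Finset.card_pair hne]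
    simp
  rw [Finset.sum_congr rfl fun p _ => h1 p, Finset.sum_comm, Finset.sum_congr rfl fun i _ => h3 i]
  simp [mul_comm]

open Classical in
theorem ncard_pointsOnConic (hZ : ∀ p, p ∈ Z ↔ 2 ≤ A.numCurvesThrough p) :
    ((A.pointsOnConic 0).ncard : ℤ) = ∑ p ∈ Z, if Vanishes (A.conic 0) p then 1 else 0 := by
  have h : A.pointsOnConic 0 = (Z.filter fun p => Vanishes (A.conic 0) p : Finset P2) := by
    ext p
    rw [pointsOnConic, Set.mem_ofPred_eq, vanishes_deleteConic_equation, Finset.mem_coe,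
      Finset.mem_filter, hZ, numCurvesThrough_eq_add]
    constructor
    · rintro ⟨h1, h2⟩; rw [if_pos h1]; exact ⟨by omega, h1⟩
    · rintro ⟨h1, h2⟩; rw [if_pos h2] at h1; exact ⟨h2, by omega⟩
  rw [h, Set.ncard_coe_finset, Finset.card_filter]
  push_cast
  rfl

/-- Besides the multiple points of the lines, `Z` contains the points where a single line crosses
the conic; these contribute `1 - 1 = 0`. -/
theorem sum_numPoints_deleteConic (hZ : ∀ p, p ∈ Z ↔ 2 ≤ A.numCurvesThrough p) :
    ∑ r ∈ Finset.Icc 2 (d + 0), ((r : ℤ) - 1) * ((A.deleteConic 0).numPoints r : ℤ) =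
      ∑ p ∈ Z, ((A.numLinesThrough p : ℤ) - 1) := by
  classical
  have h1 : ∀ r ∈ Finset.Icc 2 (d + 0), ((r : ℤ) - 1) * ((A.deleteConic 0).numPoints r : ℤ) =
      ∑ p ∈ Z, if A.numLinesThrough p = r then (r : ℤ) - 1 else 0 := by
    intro r hr
    have h2 : {p : P2 | (A.deleteConic 0).numCurvesThrough p = r} =
        (Z.filter fun p => A.numLinesThrough p = r : Finset P2) := by
      ext p
      rw [Set.mem_ofPred_eq, numCurvesThrough_deleteConic, Finset.mem_coe, Finset.mem_filter, hZ,
        numCurvesThrough_eq_add]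
      have := (Finset.mem_Icc.1 hr).1
      constructor
      · intro h; exact ⟨by omega, h⟩
      · exact fun h => h.2
    rw [numPoints, h2, Set.ncard_coe_finset, ← Finset.sum_filter, Finset.sum_const, nsmul_eq_mul,
      mul_comm]
  rw [Finset.sum_congr rfl h1, Finset.sum_comm]
  refine Finset.sum_congr rfl fun p hp => ?_
  rw [Finset.sum_ite_eq]
  split_ifs with h
  · rfl
  · have h2 := (hZ p).1 hp
    rw [numCurvesThrough_eq_add] at h2
    have h3 := A.numLinesThrough_le p
    rw [Finset.mem_Icc] at h
    have h4 : A.numLinesThrough p = 1 := by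
      split_ifs at h2 <;> omega
    rw [h4]; simp

end Count

/-- The quadratic coefficient of the Poincaré polynomial after deletion of the conic, in terms of
the degree of the Jacobian ideal. -/
theorem HasOrdinarySingularities.sum_numPoints (hA : A.HasOrdinarySingularities 4) {n : ℕ}
    (hn : HasDegree (jacobianIdeal A.equation) n) :
    ∑ r ∈ Finset.Icc 2 (d + 0), ((r : ℤ) - 1) * ((A.deleteConic 0).numPoints r : ℤ) =
      d * (d - 1) + 4 * d - (A.pointsOnConic 0).ncard - n := by
  classical
  let Z : Finset P2 := hA.finite_setOf_two_le.toFinset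
  have hZ : ∀ p, p ∈ Z ↔ 2 ≤ A.numCurvesThrough p := fun p => by
    rw [Set.Finite.mem_toFinset, Set.mem_ofPred_eq]
  have hdeg := hA.degree_jacobianIdeal (by omega) hn Z hZ
  -- The expansion of `(t + c - 1)²` with `c² = c`, arranged so that each term has a known sum over
  -- `Z`.
  have h : ∀ p ∈ Z, (((A.numCurvesThrough p - 1) ^ 2 : ℕ) : ℤ) =
      (A.numLinesThrough p : ℤ) * (A.numLinesThrough p - 1) - ((A.numLinesThrough p : ℤ) - 1) +
        2 * (if Vanishes (A.conic 0) p then (A.numLinesThrough p : ℤ) else 0) -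
        (if Vanishes (A.conic 0) p then 1 else 0) := by
    intro p hp
    have h2 := (hZ p).1 hp
    rw [Nat.cast_pow, Nat.cast_sub (by omega), numCurvesThrough_eq_add]
    split_ifs <;> push_cast <;> ring
  have hsum := Finset.sum_congr rfl h
  rw [← Nat.cast_sum, ← hdeg, Finset.sum_sub_distrib, Finset.sum_add_distrib,
    Finset.sum_sub_distrib, ← Finset.mul_sum, sum_numLinesThrough_mul_sub_one hZ,
    sum_numLinesThrough_on_conic hA hZ, ← ncard_pointsOnConic hZ] at hsum
  rw [sum_numPoints_deleteConic hZ]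
  linear_combination hsum

end Arrangement

end ConicLine

theorem theorem4p3 (d : ℕ) (hd : 3 ≤ d) (CL : ConicLine.Arrangement d 1)
    (hM : CL.IsMArrangement) (r : ℕ) (hr : r = (CL.pointsOnConic 0).ncard) (l : ℕ) :
    (d = 2 * l →
      (CL.deleteConic 0).poincarePolynomial =
        Polynomial.C ((l : ℤ) ^ 2 + l - 2 - r) * Polynomial.X ^ 2 +
          Polynomial.C (2 * (l : ℤ) - 1) * Polynomial.X + 1) ∧
    (d = 2 * l + 1 →
      (CL.deleteConic 0).poincarePolynomial =
        Polynomial.C ((l : ℤ) ^ 2 + 2 * l - r) * Polynomial.X ^ 2 +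
          Polynomial.C (2 * (l : ℤ)) * Polynomial.X + 1) := by
  constructor
  · intro hl
    -- The degree of the whole curve is `d + 2 = 2(l + 1)`, so `m = l + 1`. The truncated
    -- subtraction in `3m² - 3m + 3` is a true one since `m ≤ m²`.
    have h := hM.ordinary.sum_numPoints (hM.degree_even (l + 1) (by omega))
    rw [← hr, Nat.cast_add, Nat.cast_sub (by nlinarith)] at h
    rw [ConicLine.Arrangement.poincarePolynomial, h, hl]
    have e1 : 2 * ((0 : ℕ) : ℤ) + ((2 * l : ℕ) : ℤ) - 1 = 2 * l - 1 := by push_cast; ring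
    have e2 : ((2 * l : ℕ) : ℤ) * (((2 * l : ℕ) : ℤ) - 1) + 4 * ((2 * l : ℕ) : ℤ) - r -
        (((3 * (l + 1) ^ 2 : ℕ) : ℤ) - ((3 * (l + 1) : ℕ) : ℤ) + ((3 : ℕ) : ℤ)) -
        ((2 * l : ℕ) : ℤ) + 1 = (l : ℤ) ^ 2 + l - 2 - r := by push_cast; ring
    rw [e1, e2]
    ring
  · intro hl
    -- Here `d + 2 = 2(l + 1) + 1`, again with `m = l + 1`.
    have h := hM.ordinary.sum_numPoints (hM.degree_odd (l + 1) (by omega))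
    rw [← hr] at h
    rw [ConicLine.Arrangement.poincarePolynomial, h, hl]
    have e1 : 2 * ((0 : ℕ) : ℤ) + ((2 * l + 1 : ℕ) : ℤ) - 1 = 2 * l := by push_cast; ring
    have e2 : ((2 * l + 1 : ℕ) : ℤ) * (((2 * l + 1 : ℕ) : ℤ) - 1) + 4 * ((2 * l + 1 : ℕ) : ℤ) - r -
        ((3 * (l + 1) ^ 2 + 1 : ℕ) : ℤ) - ((2 * l + 1 : ℕ) : ℤ) + 1 =
        (l : ℤ) ^ 2 + 2 * l - r := by push_cast; ring
    rw [e1, e2]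
    ring
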